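/- Graphs are finite, undirected, without loops or parallel edges. Given a graph $G$ with node set $VG$ and edge set $EG$, a *2-matching* in $G$ is a function $x\colon EG\to\{0,1,2\}$ such that for each node $v$ the sum of the values $x(e)$ over all edges $e$ incident to $v$ is at most $2$. It is *perfect* if $\sum_{e\in EG}x(e)=|VG|$, *triangle-free* if its support $\{e\in EG : x(e)\neq 0\}$ contains no triangle, and *basic* if the set $\{e\in EG : x(e)=1\}$ partitions into a (possibly empty) collection of node-disjoint circuits of odd length. **Theorem.** There exists a constant $c>1$ such that every $3$-regular graph $G$ on $n$ nodes contains at least $c^n$ basic perfect triangle-free 2-matchings. (In particular, it contains at least $c^n$ perfect triangle-free 2-matchings.) -/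

import Mathlib

namespace CubicTwoMatching

open SimpleGraph

/-- The sum of the values `x(e)` over all edges `e` incident to the node `v`. -/
def nodeSum {V : Type*} [Fintype V] [DecidableEq V] (G : SimpleGraph V) [DecidableRel G.Adj]
    (x : G.edgeSet → Fin 3) (v : V) : ℕ :=
  ∑ e : G.edgeSet with v ∈ e.1, (x e : ℕ)

/-- A function `x : EG → {0, 1, 2}` is a 2-matching if the sum of its values on the edges
incident to any node is at most 2. -/
def IsTwoMatching {V : Type*} [Fintype V] [DecidableEq V] (G : SimpleGraph V)
    [DecidableRel G.Adj] (x : G.edgeSet → Fin 3) : Prop :=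
  ∀ v : V, nodeSum G x v ≤ 2

/-- The size of a 2-matching: the sum of its values on all edges. -/
def size {V : Type*} [Fintype V] [DecidableEq V] (G : SimpleGraph V) [DecidableRel G.Adj]
    (x : G.edgeSet → Fin 3) : ℕ :=
  ∑ e : G.edgeSet, (x e : ℕ)

/-- `x` is perfect if its size is the number of nodes. -/
def IsPerfect {V : Type*} [Fintype V] [DecidableEq V] (G : SimpleGraph V) [DecidableRel G.Adj]
    (x : G.edgeSet → Fin 3) : Prop :=
  size G x = Fintype.card V

/-- The graph on the nodes of `G` whose edges are the edges `e` of `G` with `x(e) ≠ 0`. -/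
def supp {V : Type*} (G : SimpleGraph V) (x : G.edgeSet → Fin 3) : SimpleGraph V :=
  fromEdgeSet {e : Sym2 V | ∃ h : e ∈ G.edgeSet, x ⟨e, h⟩ ≠ 0}

/-- `x` is triangle-free if its support contains no triangle. -/
def IsTriangleFree {V : Type*} (G : SimpleGraph V) (x : G.edgeSet → Fin 3) : Prop :=
  (supp G x).CliqueFree 3

/-- A subgraph of `G` is an odd circuit if it is traced by a simple closed walk of odd length. -/
def IsOddCircuit {V : Type*} (G : SimpleGraph V) (C : G.Subgraph) : Prop :=
  ∃ (v : V) (p : G.Walk v v), p.IsCycle ∧ Odd p.length ∧ C = p.toSubgraph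

/-- `x` is basic if the edges `e` with `x(e) = 1` partition into a collection of node-disjoint
circuits of odd length. -/
def IsBasic {V : Type*} (G : SimpleGraph V) (x : G.edgeSet → Fin 3) : Prop :=
  ∃ 𝒞 : Set G.Subgraph, (∀ C ∈ 𝒞, IsOddCircuit G C) ∧
    𝒞.PairwiseDisjoint Subgraph.verts ∧
    {e : Sym2 V | ∃ h : e ∈ G.edgeSet, x ⟨e, h⟩ = 1} = ⋃ C ∈ 𝒞, C.edgeSet

end CubicTwoMatching

namespace CubicTwoMatching

open SimpleGraph

set_option linter.unusedSectionVars false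

/-! ### Permanents of matrices with line sums three: Voorhoeve's bound -/

section Permanent

open Matrix Equiv

/-! Contract a maximal family of disjoint triangles. Since G is cubic, the edges between classes
form a 3-regular multigraph on m ≥ n/3 nodes, and Voorhoeve's bound (`CubicMatrix.four_pow_le`)
shows that its adjacency matrix has permanent at least (4/3)^m. The permanent counts the
permutations σ of the classes together with an arc of G from each class p to σ p. Each such choice
lifts to a permutation τ of V moving every node to a neighbour (`IsContraction.exists_lift`), and
different choices have different lifts (`IsLift.unique`).

Give weight 1 to the arcs v → τ v in odd orbits of τ, and alternately 2 and 0 in even orbits. The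
two ways of alternating yield a pair of basic perfect 2-matchings. They are triangle-free because a
lift has no orbit of size three (`IsLift.apply_three_ne`): this is where maximality of the family
enters.

The pair determines τ up to reversal of its odd orbits (`card_fiber_le`). Inside a class, τ runs
along a path of even length, so an odd orbit enters an odd number of classes, and more than one;
hence there are at most m/3 odd orbits. If B is the number of good 2-matchings, then (4/3)^m ≤
2^(m/3) B^2, so (32/27)^m ≤ B^6 and (32/27)^n ≤ B^18. -/

theorem permanent_updateRow_add {ι R : Type*} [DecidableEq ι] [Fintype ι] [CommSemiring R]
    (M : Matrix ι ι R) (i : ι) (u v : ι → R) :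
    permanent (updateRow M i (u + v)) =
      permanent (updateRow M i u) + permanent (updateRow M i v) := by
  have key : ∀ (N : Matrix ι ι R) (j : ι) (u v : ι → R), permanent (updateCol N j (u + v)) =
      permanent (updateCol N j u) + permanent (updateCol N j v) := by
    intro N j u v
    simp only [permanent, ← Finset.mul_prod_erase _ _ (Finset.mem_univ j), updateCol_self,
      Pi.add_apply, add_mul, Finset.sum_add_distrib]
    congr 1 <;> refine Finset.sum_congr rfl fun σ _ => ?_ <;> congr 1 <;>
      refine Finset.prod_congr rfl fun k hk => ?_ <;>
      simp [updateCol_ne (Finset.ne_of_mem_erase hk)]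
  rw [← permanent_transpose, ← updateCol_transpose, key, updateCol_transpose, updateCol_transpose,
    permanent_transpose, permanent_transpose]

/-- The permanent as an additive function of one row. -/
def permanentRow {ι : Type*} [DecidableEq ι] [Fintype ι] (M : Matrix ι ι ℕ) (i : ι) :
    (ι → ℕ) →+ ℕ where
  toFun u := permanent (updateRow M i u)
  map_zero' := by simpa using permanent_updateRow_smul M i 0 0
  map_add' u v := permanent_updateRow_add M i u v

theorem permanent_eq_permanentRow {ι : Type*} [DecidableEq ι] [Fintype ι] (M : Matrix ι ι ℕ)
    (i : ι) : permanent M = permanentRow M i (M i) := by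
  simp [permanentRow]

/-- Expansion of the permanent along the first column. -/
theorem permanent_succ {n : ℕ} (M : Matrix (Fin (n + 1)) (Fin (n + 1)) ℕ) :
    permanent M = ∑ p, M p 0 * permanent (Matrix.of fun i j => M (swap 0 p (Fin.succ i)) (Fin.succ j)) := by
  unfold permanent
  rw [← (Perm.decomposeFin (n := n)).symm.sum_comp, Fintype.sum_prod_type]
  simp [Fin.prod_univ_succ, Finset.mul_sum]

theorem AddMonoidHom.apply_eq_sum_single {ι : Type*} [DecidableEq ι] [Fintype ι]
    (L : (ι → ℕ) →+ ℕ) (u : ι → ℕ) : L u = ∑ j, u j * L (Pi.single j 1) := by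
  conv_lhs => rw [← Finset.univ_sum_single u]
  rw [map_sum]
  refine Finset.sum_congr rfl fun j _ => ?_
  rw [← smul_eq_mul, ← map_nsmul, ← Pi.single_smul]
  simp

/-- The averaging step of Voorhoeve's argument. With s the sum of `u`, additivity gives ∑ u j * L (u
- e_j) = (s - 1) * L u, so a lower bound `K` for the reduced rows improves by the factor s/(s - 1):
3/2 for a row of sum three, 4/3 for a row of sum four. The conclusion is arranged to avoid truncated
subtraction. -/
theorem le_apply_of_le_apply_sub_single {ι : Type*} [DecidableEq ι] [Fintype ι]
    (L : (ι → ℕ) →+ ℕ) (u : ι → ℕ) (c K : ℕ)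
    (h : ∀ j, u j ≠ 0 → K ≤ c * L (u - Pi.single j 1)) :
    (∑ j, u j) * K + c * L u ≤ (∑ j, u j) * (c * L u) := by
  have h1 : ∀ j, u j * K + u j * (c * L (Pi.single j 1)) ≤ u j * (c * L u) := by
    intro j
    rcases eq_or_ne (u j) 0 with hj | hj
    · simp [hj]
    · have h2 : L (u - Pi.single j 1) + L (Pi.single j 1) = L u := by
        rw [← map_add]
        congr 1
        ext k
        rcases eq_or_ne k j with rfl | hk
        · simp; omega
        · simp [hk]
      rw [← h2, ← mul_add, mul_add c]
      exact Nat.mul_le_mul_left _ (Nat.add_le_add_right (h j hj) _)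
  calc (∑ j, u j) * K + c * L u
      = ∑ j, (u j * K + u j * (c * L (Pi.single j 1))) := by
        rw [AddMonoidHom.apply_eq_sum_single L u, Finset.sum_add_distrib, Finset.sum_mul,
          Finset.mul_sum]
        congr 1
        exact Finset.sum_congr rfl fun j _ => by ring
    _ ≤ ∑ j, u j * (c * L u) := Finset.sum_le_sum fun j _ => h1 j
    _ = _ := by rw [Finset.sum_mul]

/-- All row and column sums are three. -/
def CubicMatrix {ι : Type*} [Fintype ι] (M : Matrix ι ι ℕ) : Prop :=
  (∀ i, ∑ j, M i j = 3) ∧ ∀ j, ∑ i, M i j = 3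

/-- All row and column sums are three, except that one row and one column have sum two. -/
def NearCubicMatrix {ι : Type*} [Fintype ι] [DecidableEq ι] (M : Matrix ι ι ℕ) (r s : ι) : Prop :=
  (∀ i, ∑ j, M i j = if i = r then 2 else 3) ∧ ∀ j, ∑ i, M i j = if j = s then 2 else 3

theorem sum_sub_single {ι : Type*} [DecidableEq ι] [Fintype ι] (u : ι → ℕ) (j : ι)
    (hj : u j ≠ 0) : (∑ k, (u - Pi.single j 1 : ι → ℕ) k) + 1 = ∑ k, u k := by
  have h : u = (u - Pi.single j 1) + Pi.single j 1 := by
    ext k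
    rcases eq_or_ne k j with rfl | hk
    · simp; omega
    · simp [hk]
  conv_rhs => rw [h]
  simp only [Pi.add_apply, Finset.sum_add_distrib, Finset.sum_pi_single', Finset.mem_univ, if_true]

theorem exists_eq_single_of_sum_eq_one {ι : Type*} [DecidableEq ι] [Fintype ι] (u : ι → ℕ)
    (h : ∑ k, u k = 1) : ∃ j, u = Pi.single j 1 := by
  obtain ⟨j, -, hj⟩ := Finset.exists_ne_zero_of_sum_ne_zero (h.trans_ne one_ne_zero)
  refine ⟨j, ?_⟩
  have h1 := sum_sub_single u j hj
  have h2 : ∑ k, (u - Pi.single j 1 : ι → ℕ) k = 0 := by omega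
  ext k
  have h3 := (Finset.sum_eq_zero_iff.1 h2) k (Finset.mem_univ k)
  rcases eq_or_ne k j with rfl | hk
  · simp at h3 ⊢; omega
  · simpa [hk] using h3

theorem sum_updateRow_col {ι : Type*} [DecidableEq ι] [Fintype ι] (M : Matrix ι ι ℕ) (r j : ι)
    (u : ι → ℕ) : (∑ i, updateRow M r u i j) + M r j = (∑ i, M i j) + u j := by
  rw [← Finset.add_sum_erase _ _ (Finset.mem_univ r),
    ← Finset.add_sum_erase _ (fun i => M i j) (Finset.mem_univ r)]
  rw [Finset.sum_congr rfl (fun i hi => by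
    rw [updateRow_ne (Finset.ne_of_mem_erase hi)] : ∀ i ∈ Finset.univ.erase r,
      updateRow M r u i j = M i j)]
  simp
  omega

/-- Decreasing a unit in row `r` of a matrix whose other rows have sum three. -/
theorem nearCubic_updateRow_sub {ι : Type*} [DecidableEq ι] [Fintype ι] (M : Matrix ι ι ℕ)
    (r j : ι) (hj : M r j ≠ 0) (s : ι)
    (hr : ∀ i, i ≠ r → ∑ k, M i k = if i = s then 2 else 3)
    (hs : ∑ k, M r k = if r = s then 3 else 4) (hc : ∀ k, ∑ i, M i k = 3) :
    NearCubicMatrix (updateRow M r (M r - Pi.single j 1)) s j := by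
  constructor
  · intro i
    rcases eq_or_ne i r with rfl | hi
    · have := sum_sub_single (M i) j hj
      simp only [updateRow_self]
      split_ifs at hs ⊢ <;> omega
    · simp only [updateRow_ne hi, hr i hi]
  · intro k
    have := sum_updateRow_col M r k (M r - Pi.single j 1)
    rw [hc] at this
    rcases eq_or_ne k j with rfl | hk
    · simp at this ⊢; omega
    · simp [hk] at this ⊢; omega

theorem CubicMatrix.le_permanent {ι : Type*} [DecidableEq ι] [Fintype ι] (r : ι) {c K : ℕ}
    (h : ∀ (N : Matrix ι ι ℕ) (r s : ι), NearCubicMatrix N r s → K ≤ c * permanent N)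
    {M : Matrix ι ι ℕ} (hM : CubicMatrix M) : 3 * K ≤ 2 * (c * permanent M) := by
  have := le_apply_of_le_apply_sub_single (permanentRow M r) (M r) c K (fun j hj => by
    refine h _ r j (nearCubic_updateRow_sub M r j hj r (fun i hi => ?_) ?_ hM.2)
    · simp [hi, hM.1]
    · simp [hM.1])
  rw [hM.1, ← permanent_eq_permanentRow] at this
  omega

/-- The induction step for `NearCubicMatrix`, when the deficient column is the first one and
meets the first row. -/
theorem NearCubicMatrix.le_permanent_succ {n : ℕ} {c K : ℕ}
    (h : ∀ (N : Matrix (Fin (n + 1)) (Fin (n + 1)) ℕ) (r s), NearCubicMatrix N r s →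
      K ≤ c * permanent N)
    {M : Matrix (Fin (n + 2)) (Fin (n + 2)) ℕ} {r : Fin (n + 2)} (hM : NearCubicMatrix M r 0)
    (h0 : M 0 0 ≠ 0) : 4 * K ≤ 3 * (c * permanent M) := by
  obtain ⟨hr, hc⟩ := hM
  have hrow : ∀ i, M i 0 + ∑ j : Fin (n + 1), M i j.succ = if i = r then 2 else 3 := fun i => by
    rw [← hr i, Fin.sum_univ_succ (n := n + 1)]
  have hcol : ∀ j, M 0 j + ∑ i : Fin (n + 1), M i.succ j = if j = 0 then 2 else 3 := fun j => by
    rw [← hc j, Fin.sum_univ_succ (n := n + 1)]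
  have hcol0 := hcol 0
  rw [if_pos rfl] at hcol0
  have hcolS : ∀ j : Fin (n + 1), M 0 j.succ + ∑ i : Fin (n + 1), M i.succ j.succ = 3 := fun j => by
    rw [hcol, if_neg (Fin.succ_ne_zero j)]
  set M' : Matrix (Fin (n + 1)) (Fin (n + 1)) ℕ := Matrix.of fun i j => M i.succ j.succ with hM'
  have hexp := permanent_succ M
  rw [Fin.sum_univ_succ] at hexp
  simp only [swap_self, refl_apply] at hexp
  rw [← hM'] at hexp
  -- Column 0 has sum two and a nonzero corner, so it holds either a single 2 or two ones. A single
  -- 2 makes the permanent twice that of the minor `M'`, which is cubic or near-cubic; this gains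
  -- more than the required 4/3.
  rcases eq_or_ne (∑ i : Fin (n + 1), M i.succ 0) 0 with hz | hz
  · have hz' : ∀ i : Fin (n + 1), M i.succ 0 = 0 := fun i =>
      Finset.sum_eq_zero_iff.1 hz i (Finset.mem_univ i)
    have h2 : M 0 0 = 2 := by omega
    simp only [hz', zero_mul, Finset.sum_const_zero, add_zero, h2] at hexp
    have hrow0 := hrow 0
    rcases eq_or_ne (0 : Fin (n + 2)) r with rfl | hr0
    · have hcub : CubicMatrix M' := by
        constructor
        · intro i
          have := hrow i.succ
          rw [hz', if_neg (Fin.succ_ne_zero i), zero_add] at this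
          exact this
        · intro j
          have h3 := hcolS j
          rw [if_pos rfl, h2] at hrow0
          have h4 : M 0 j.succ = 0 :=
            Finset.sum_eq_zero_iff.1 (by omega : ∑ j : Fin (n + 1), M 0 j.succ = 0) j
              (Finset.mem_univ j)
          rw [h4, zero_add] at h3
          exact h3
      have := CubicMatrix.le_permanent 0 h hcub
      rw [hexp, mul_left_comm c]
      omega
    · rw [if_neg hr0, h2] at hrow0
      obtain ⟨q, hq⟩ := exists_eq_single_of_sum_eq_one (fun j : Fin (n + 1) => M 0 j.succ)
        (by omega)
      obtain ⟨r', rfl⟩ := Fin.exists_succ_eq.2 hr0.symm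
      have hnear : NearCubicMatrix M' r' q := by
        constructor
        · intro i
          have := hrow i.succ
          rw [hz', zero_add] at this
          simpa [hM', Fin.succ_inj] using this
        · intro j
          have h3 := hcolS j
          have h4 := congrFun hq j
          simp only [hM', Matrix.of_apply]
          simp only [Pi.single_apply] at h4
          split_ifs at h4 ⊢ <;> omega
      have := h _ _ _ hnear
      rw [hexp, mul_left_comm c]
      omega
  · have h1 : M 0 0 = 1 := by omega
    obtain ⟨q, hq⟩ := exists_eq_single_of_sum_eq_one (fun i : Fin (n + 1) => M i.succ 0)
      (by omega)
    have hq' : ∀ i : Fin (n + 1), M i.succ 0 = if i = q then 1 else 0 := fun i => by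
      simpa [Pi.single_apply] using congrFun hq i
    -- The ones of column 0 lie in rows 0 and `q.succ`. The two minors of the expansion differ, up
    -- to row order, only in row `q`, so they add up to one permanent in which the two rows are
    -- merged into `u`.
    set u : Fin (n + 1) → ℕ := fun j => M q.succ j.succ + M 0 j.succ with hu
    have hperm : permanent M = permanentRow M' q u := by
      have : u = M' q + fun j => M 0 j.succ := rfl
      rw [this, map_add, ← permanent_eq_permanentRow, hexp, h1, one_mul]
      simp only [hq', ite_mul, one_mul, zero_mul, Finset.sum_ite_eq', Finset.mem_univ, if_true]
      congr 2
      ext i j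
      rcases eq_or_ne i q with rfl | hi
      · simp
      · simp [updateRow_ne hi, swap_apply_of_ne_of_ne (Fin.succ_ne_zero i)
          (fun h => hi (Fin.succ_injective _ h)), hM']
    set W := updateRow M' q u with hW
    have hWu : W q = u := by simp [hW]
    have hWrow : permanentRow W q u = permanent M := by
      rw [hperm]; simp [permanentRow, hW]
    have hcW : ∀ k, ∑ i, W i k = 3 := by
      intro k
      have h3 := sum_updateRow_col M' q k u
      have h4 := hcolS k
      simp only [hM', Matrix.of_apply, hu] at h3
      simp only [hW, hM', hu]
      omega
    have hrW : ∀ i, i ≠ q → ∑ k, W i k = if i.succ = r then 2 else 3 := by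
      intro i hi
      have := hrow i.succ
      rw [hq', if_neg hi, zero_add] at this
      simpa [hW, hM', updateRow_ne hi] using this
    have hsW : (∑ k, u k) + 2 = (if q.succ = r then 2 else 3) + if 0 = r then 2 else 3 := by
      rw [← hrow, ← hrow, hq', if_pos rfl, h1, hu, Finset.sum_add_distrib]
      ring
    -- If a merged row was deficient, `u` has sum three, `W` is cubic, and the gain is 3/2.
    -- Otherwise `u` has sum four, and removing a unit from it leaves a near-cubic matrix; this is
    -- the critical case, with gain exactly 4/3.
    by_cases hcase : q.succ = r ∨ 0 = r
    · have h3 : ∑ k, u k = 3 := by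
        rcases hcase with h5 | h5
        · subst h5; simp [(Fin.succ_ne_zero _).symm] at hsW; omega
        · subst h5; simp [Fin.succ_ne_zero] at hsW; omega
      have hcub : CubicMatrix W := by
        refine ⟨fun i => ?_, hcW⟩
        rcases eq_or_ne i q with rfl | hi
        · rw [hWu, h3]
        · rw [hrW i hi, if_neg]
          rintro rfl
          rcases hcase with h5 | h5
          · exact hi (Fin.succ_injective _ h5).symm
          · exact (Fin.succ_ne_zero _) h5.symm
      have := CubicMatrix.le_permanent 0 h hcub
      rw [permanent_eq_permanentRow W q, hWu, hWrow] at this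
      omega
    · push Not at hcase
      rw [if_neg hcase.1, if_neg hcase.2] at hsW
      obtain ⟨r', rfl⟩ := Fin.exists_succ_eq.2 hcase.2.symm
      have h5 : q ≠ r' := fun h => hcase.1 (by rw [h])
      have := le_apply_of_le_apply_sub_single (permanentRow W q) u c K (fun j hj => by
        rw [← hWu]
        refine h _ r' j (nearCubic_updateRow_sub W q j (by rwa [hWu]) r' (fun i hi => ?_) ?_ hcW)
        · rw [hrW i hi]; simp [Fin.succ_inj]
        · rw [hWu, if_neg h5]; omega)
      rw [hWrow, (by omega : ∑ k, u k = 4)] at this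
      omega

theorem NearCubicMatrix.le_permanent {n : ℕ} :
    ∀ (M : Matrix (Fin (n + 1)) (Fin (n + 1)) ℕ) (r s), NearCubicMatrix M r s →
      2 * 4 ^ n ≤ 3 ^ n * permanent M := by
  induction n with
  | zero =>
    intro M r s hM
    have := hM.1 0
    have hr : r = 0 := Subsingleton.elim (α := Fin 1) _ _
    have h2 : M 0 0 = 2 := by simpa [hr] using this
    rw [permanent_eq_elem_of_card_eq_one (by simp) 0, h2]
    norm_num
  | succ n ih =>
    intro M r s hM
    have hs := hM.2 s
    rw [if_pos rfl] at hs
    obtain ⟨p, -, hp⟩ := Finset.exists_ne_zero_of_sum_ne_zero (hs.trans_ne two_ne_zero)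
    -- Permuting rows and columns brings a nonzero entry of the deficient column to the corner.
    set M₂ := (M.submatrix (swap 0 p) id).submatrix id (swap 0 s) with hM₂
    have hperm : permanent M₂ = permanent M := by
      rw [hM₂, permanent_permute_rows, permanent_permute_cols]
    have hnear : NearCubicMatrix M₂ (swap 0 p r) 0 := by
      constructor
      · intro i
        simp only [hM₂, submatrix_apply, id]
        rw [Equiv.sum_comp (swap 0 s) (fun j => M (swap 0 p i) j), hM.1]
        simp only [swap_apply_eq_iff]
      · intro j
        simp only [hM₂, submatrix_apply, id]
        rw [Equiv.sum_comp (swap 0 p) (fun i => M i (swap 0 s j)), hM.2]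
        simp only [swap_apply_eq_iff, swap_apply_right]
    have := NearCubicMatrix.le_permanent_succ ih hnear (by simpa [hM₂] using hp)
    rw [← hperm, pow_succ, pow_succ]
    linarith

theorem permanent_submatrix_equiv {ι κ R : Type*} [DecidableEq ι] [Fintype ι] [DecidableEq κ]
    [Fintype κ] [CommSemiring R] (e : ι ≃ κ) (M : Matrix κ κ R) :
    permanent (M.submatrix e e) = permanent M := by
  unfold permanent
  rw [← (permCongr e).sum_comp]
  refine Finset.sum_congr rfl fun σ _ => ?_
  rw [← e.prod_comp]
  simp

/-- Voorhoeve's bound. -/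
theorem CubicMatrix.four_pow_le {ι : Type*} [DecidableEq ι] [Fintype ι] {M : Matrix ι ι ℕ}
    (hM : CubicMatrix M) : 4 ^ Fintype.card ι ≤ 3 ^ Fintype.card ι * permanent M := by
  rcases hn : Fintype.card ι with _ | n
  · simp [permanent_eq_one_of_card_eq_zero hn]
  · let e := (Fintype.equivFinOfCardEq hn).symm
    have h2 : CubicMatrix (M.submatrix e e) :=
      ⟨fun i => (e.sum_comp (fun j => M (e i) j)).trans (hM.1 _),
        fun j => (e.sum_comp (fun i => M i (e j))).trans (hM.2 _)⟩
    have := CubicMatrix.le_permanent 0 NearCubicMatrix.le_permanent h2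
    rw [permanent_submatrix_equiv] at this
    rw [pow_succ, pow_succ]
    have h3 := Nat.zero_le (4 ^ n)
    linarith

end Permanent

/-! ### Orbits of a permutation and alternating colourings -/

section Orbit

variable {V : Type*} [Fintype V] [DecidableEq V] (τ : Equiv.Perm V)

/-- The orbit of `v` under `τ`. -/
noncomputable def orbitFinset (v : V) : Finset V :=
  (Finset.range (Function.minimalPeriod τ v)).image fun i => τ^[i] v

theorem mem_periodicPts (v : V) : v ∈ Function.periodicPts τ := τ.injective.mem_periodicPts v

theorem minimalPeriod_pos (v : V) : 0 < Function.minimalPeriod τ v :=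
  Function.minimalPeriod_pos_of_mem_periodicPts (mem_periodicPts τ v)

theorem card_orbitFinset (v : V) : (orbitFinset τ v).card = Function.minimalPeriod τ v := by
  rw [orbitFinset, Finset.card_image_of_injOn, Finset.card_range]
  intro i hi j hj h
  exact Function.iterate_injOn_Iio_minimalPeriod (by simpa using hi) (by simpa using hj) h

variable {τ}

theorem mem_orbitFinset {v u : V} : u ∈ orbitFinset τ v ↔ τ.SameCycle v u := by
  simp only [orbitFinset, Finset.mem_image, Finset.mem_range]
  constructor
  · rintro ⟨i, -, rfl⟩
    exact ⟨i, by rw [zpow_natCast, Equiv.Perm.iterate_eq_pow]⟩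
  · intro h
    obtain ⟨i, rfl⟩ := h.exists_nat_pow_eq
    refine ⟨i % Function.minimalPeriod τ v, Nat.mod_lt _ (minimalPeriod_pos τ v), ?_⟩
    rw [Function.iterate_mod_minimalPeriod_eq, Equiv.Perm.iterate_eq_pow]

theorem self_mem_orbitFinset (v : V) : v ∈ orbitFinset τ v :=
  mem_orbitFinset.2 (Equiv.Perm.SameCycle.refl τ v)

theorem orbitFinset_eq {v u : V} (h : u ∈ orbitFinset τ v) : orbitFinset τ u = orbitFinset τ v := by
  rw [mem_orbitFinset] at h
  ext w
  rw [mem_orbitFinset, mem_orbitFinset]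
  exact ⟨h.trans, h.symm.trans⟩

theorem apply_mem_orbitFinset {v u : V} : τ u ∈ orbitFinset τ v ↔ u ∈ orbitFinset τ v := by
  rw [mem_orbitFinset, mem_orbitFinset, Equiv.Perm.sameCycle_apply_right]

theorem minimalPeriod_eq_of_sameCycle {v u : V} (h : τ.SameCycle v u) :
    Function.minimalPeriod τ u = Function.minimalPeriod τ v := by
  rw [← card_orbitFinset, ← card_orbitFinset, orbitFinset_eq (mem_orbitFinset.2 h)]

theorem minimalPeriod_map (v : V) :
    Function.minimalPeriod τ (τ v) = Function.minimalPeriod τ v :=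
  Function.minimalPeriod_apply (mem_periodicPts τ v)

/-- A representative of the orbit of `v`, which depends on the orbit only. -/
noncomputable def orbitRoot (τ : Equiv.Perm V) (v : V) : V :=
  (⟨v, self_mem_orbitFinset v⟩ : (orbitFinset τ v).Nonempty).choose

theorem orbitRoot_mem (v : V) : orbitRoot τ v ∈ orbitFinset τ v :=
  (⟨v, self_mem_orbitFinset v⟩ : (orbitFinset τ v).Nonempty).choose_spec

/-- The root is chosen from the orbit as a bare set, so permutations that traverse the same set in
opposite directions share their root. This lets the root detect the direction of an even orbit. -/
theorem orbitRoot_eq {τ τ' : Equiv.Perm V} {v u : V} (h : orbitFinset τ v = orbitFinset τ' u) :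
    orbitRoot τ v = orbitRoot τ' u := by
  simp only [orbitRoot, h]

/-- The even orbits of a permutation can be coloured alternatingly, with prescribed roots. -/
theorem exists_alternating (τ : Equiv.Perm V) :
    ∃ col : V → Bool, (∀ v, Even (Function.minimalPeriod τ v) → col (τ v) = !col v) ∧
      ∀ v, col (orbitRoot τ v) = true := by
  have hex : ∀ v, ∃ i, i < Function.minimalPeriod τ v ∧ τ^[i] (orbitRoot τ v) = v := by
    intro v
    have h := (mem_orbitFinset.1 (orbitRoot_mem (τ := τ) v)).symm
    obtain ⟨i, hi, h2⟩ := Finset.mem_image.1 (mem_orbitFinset.2 h)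
    rw [Finset.mem_range, minimalPeriod_eq_of_sameCycle h.symm] at hi
    exact ⟨i, hi, h2⟩
  choose k hk hkv using hex
  have hper : ∀ v, Function.minimalPeriod τ (orbitRoot τ v) = Function.minimalPeriod τ v :=
    fun v => minimalPeriod_eq_of_sameCycle (mem_orbitFinset.1 (orbitRoot_mem v))
  have huniq : ∀ v j, j < Function.minimalPeriod τ v → τ^[j] (orbitRoot τ v) = v →
      j = k v := fun v j hj h =>
    Function.iterate_injOn_Iio_minimalPeriod (f := τ) (x := orbitRoot τ v)
      (by simpa [hper] using hj) (by simpa [hper] using hk v) (h.trans (hkv v).symm)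
  refine ⟨fun v => decide (Even (k v)), fun v hv => ?_, fun v => ?_⟩
  · have horb : orbitRoot τ (τ v) = orbitRoot τ v :=
      orbitRoot_eq (orbitFinset_eq (apply_mem_orbitFinset.2 (self_mem_orbitFinset v)))
    have hstep : τ^[k v + 1] (orbitRoot τ v) = τ v := by
      rw [Function.iterate_succ_apply', hkv]
    by_cases hlt : k v + 1 < Function.minimalPeriod τ v
    · have := huniq (τ v) (k v + 1) (by rwa [minimalPeriod_map]) (by rwa [horb])
      simp [← this, Nat.even_add_one, -Nat.not_even_iff_odd]
    -- Wrap-around: the last index is odd because the period is even, and the next index is 0.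
    · have heq : k v + 1 = Function.minimalPeriod τ v := by have := hk v; omega
      have h0 : τ^[0] (orbitRoot τ v) = τ v := by
        rw [← hstep, heq, ← hper, Function.iterate_minimalPeriod]; rfl
      have := huniq (τ v) 0 (minimalPeriod_pos τ _) (by rwa [horb])
      rw [← heq, Nat.even_add_one] at hv
      simp [← this, hv]
  · have horb := orbitRoot_eq (orbitFinset_eq (orbitRoot_mem (τ := τ) v))
    have := huniq (orbitRoot τ v) 0 (minimalPeriod_pos τ _) (by rw [horb]; rfl)
    simp [← this]

end Orbit

/-! ### Odd orbits as odd circuits -/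

section Walk

variable {V : Type*} {G : SimpleGraph V} {τ : Equiv.Perm V}

/-- The walk `v, τ v, τ (τ v), …`. -/
def iterWalk (hτ : ∀ v, G.Adj v (τ v)) : ∀ (n : ℕ) (v : V), G.Walk v (τ^[n] v)
  | 0, _ => Walk.nil
  | n + 1, v => Walk.cons (hτ v) (iterWalk hτ n (τ v))

variable (hτ : ∀ v, G.Adj v (τ v))

theorem length_iterWalk (n : ℕ) (v : V) : (iterWalk hτ n v).length = n := by
  induction n generalizing v with
  | zero => rfl
  | succ n ih => simp [iterWalk, ih]

theorem support_iterWalk (n : ℕ) (v : V) :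
    (iterWalk hτ n v).support = (List.range (n + 1)).map fun i => τ^[i] v := by
  induction n generalizing v with
  | zero => simp [iterWalk]
  | succ n ih =>
    rw [List.range_succ_eq_map]
    simp [iterWalk, ih, Function.comp_def]

theorem edges_iterWalk (n : ℕ) (v : V) :
    (iterWalk hτ n v).edges = (List.range n).map fun i => s(τ^[i] v, τ^[i + 1] v) := by
  induction n generalizing v with
  | zero => simp [iterWalk]
  | succ n ih =>
    rw [List.range_succ_eq_map]
    simp [iterWalk, ih, Function.comp_def]

variable [Fintype V] [DecidableEq V]

/-- The subgraph traced by the orbit of `v`. -/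
def orbitSubgraph (v : V) : G.Subgraph where
  verts := {u | τ.SameCycle v u}
  Adj a b := τ.SameCycle v a ∧ (τ a = b ∨ τ b = a)
  adj_sub := by
    rintro a b ⟨-, rfl | rfl⟩
    · exact hτ a
    · exact (hτ b).symm
  edge_vert h := h.1
  symm := by
    constructor
    rintro a b ⟨h, rfl | rfl⟩
    · exact ⟨Equiv.Perm.sameCycle_apply_right.2 h, Or.inr rfl⟩
    · exact ⟨Equiv.Perm.sameCycle_apply_right.1 h, Or.inl rfl⟩

/-- Period 1 is impossible since adjacent nodes differ, and period 2 is even, so the orbit has at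
least three nodes and closes up to a genuine circuit. -/
theorem isOddCircuit_orbitSubgraph (v : V) (hodd : Odd (Function.minimalPeriod τ v)) :
    IsOddCircuit G (orbitSubgraph hτ v) := by
  obtain ⟨n, hn⟩ : ∃ n, Function.minimalPeriod τ v = n + 1 :=
    Nat.exists_eq_succ_of_ne_zero (minimalPeriod_pos τ v).ne'
  have hn0 : n ≠ 0 := by
    rintro rfl
    exact (hτ v).ne (Function.minimalPeriod_eq_one_iff_isFixedPt.1 hn).symm
  have hn2 : 2 ≤ n := by
    rw [hn] at hodd
    have := Nat.odd_iff.1 hodd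
    omega
  have hclose : τ^[n] (τ v) = v := by
    rw [← Function.iterate_succ_apply, Nat.succ_eq_add_one, ← hn, Function.iterate_minimalPeriod]
  have hinj : ∀ i j, i ≤ n → j ≤ n → τ^[i] v = τ^[j] v → i = j := fun i j hi hj h =>
    Function.iterate_injOn_Iio_minimalPeriod (by simp; omega) (by simp; omega) h
  have hinj' : ∀ i j, i ≤ n → j ≤ n → τ^[i] (τ v) = τ^[j] (τ v) → i = j := fun i j hi hj h =>
    Function.iterate_injOn_Iio_minimalPeriod (f := τ) (x := τ v)
      (by simp [minimalPeriod_map]; omega) (by simp [minimalPeriod_map]; omega) h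
  let p : G.Walk v v := Walk.cons (hτ v) ((iterWalk hτ n (τ v)).copy rfl hclose)
  have hps : p.support = v :: (List.range (n + 1)).map fun i => τ^[i] (τ v) := by
    rw [Walk.support_cons, Walk.support_copy, support_iterWalk]
  have hpe : p.edges =
      s(v, τ v) :: (List.range n).map fun i => s(τ^[i] (τ v), τ^[i + 1] (τ v)) := by
    rw [Walk.edges_cons, Walk.edges_copy, edges_iterWalk]
  refine ⟨v, p, ?_, ?_, ?_⟩
  · rw [Walk.cons_isCycle_iff]
    constructor
    · rw [Walk.isPath_copy, Walk.isPath_def, support_iterWalk]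
      refine List.Nodup.map_on ?_ List.nodup_range
      intro i hi j hj h
      rw [List.mem_range] at hi hj
      exact hinj' i j (by omega) (by omega) h
    · rw [Walk.edges_copy, edges_iterWalk, List.mem_map]
      rintro ⟨i, hi, h⟩
      rw [List.mem_range] at hi
      rw [Sym2.eq_iff] at h
      rw [← Function.iterate_succ_apply, ← Function.iterate_succ_apply] at h
      rcases h with ⟨h, -⟩ | ⟨h1, h2⟩
      · have := hinj (i + 1) 0 (by omega) (by omega) h
        omega
      · have := hinj (i + 1) 1 (by omega) (by omega) h1
        have hi0 : i = 0 := by omega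
        subst hi0
        have := hinj 2 0 (by omega) (by omega) h2
        omega
  · simp only [p, Walk.length_cons, Walk.length_copy, length_iterWalk, ← hn]
    exact hodd
  · have hmem : ∀ u, τ.SameCycle v u ↔ ∃ i, i < n + 1 ∧ τ^[i] v = u := fun u => by
      rw [← mem_orbitFinset, orbitFinset, hn]
      simp
    ext a b
    · rw [Walk.mem_verts_toSubgraph]
      simp only [hps, List.mem_cons, List.mem_map, List.mem_range, ← Function.iterate_succ_apply]
      change τ.SameCycle v a ↔ _
      constructor
      · rw [hmem]
        rintro ⟨i, hi, rfl⟩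
        rcases i with _ | i
        · exact Or.inl rfl
        · exact Or.inr ⟨i, by omega, rfl⟩
      · rintro (rfl | ⟨i, -, rfl⟩)
        · exact Equiv.Perm.SameCycle.refl τ _
        · exact ⟨(i + 1 : ℕ), by rw [zpow_natCast, Equiv.Perm.iterate_eq_pow]⟩
    · rw [Walk.adj_toSubgraph_iff_mem_edges]
      have hedges : ∀ e, e ∈ p.edges ↔ ∃ i, i < n + 1 ∧ s(τ^[i] v, τ^[i + 1] v) = e := by
        intro e
        simp only [hpe, List.mem_cons, List.mem_map, List.mem_range, ← Function.iterate_succ_apply]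
        constructor
        · rintro (rfl | ⟨i, hi, rfl⟩)
          · exact ⟨0, by omega, rfl⟩
          · exact ⟨i + 1, by omega, rfl⟩
        · rintro ⟨i, hi, rfl⟩
          rcases i with _ | i
          · exact Or.inl rfl
          · exact Or.inr ⟨i, by omega, rfl⟩
      rw [hedges]
      change (τ.SameCycle v a ∧ (τ a = b ∨ τ b = a)) ↔ _
      constructor
      · rintro ⟨h, rfl | rfl⟩
        · obtain ⟨i, hi, rfl⟩ := (hmem _).1 h
          exact ⟨i, hi, by rw [Function.iterate_succ_apply']⟩
        · obtain ⟨i, hi, rfl⟩ := (hmem _).1 (Equiv.Perm.sameCycle_apply_right.1 h)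
          exact ⟨i, hi, by rw [Function.iterate_succ_apply', Sym2.eq_swap]⟩
      · rintro ⟨i, hi, h⟩
        have hs : τ.SameCycle v (τ^[i] v) := (hmem _).2 ⟨i, hi, rfl⟩
        rw [Function.iterate_succ_apply', Sym2.eq_iff] at h
        rcases h with ⟨rfl, rfl⟩ | ⟨rfl, rfl⟩
        · exact ⟨hs, Or.inl rfl⟩
        · exact ⟨Equiv.Perm.sameCycle_apply_right.2 hs, Or.inr rfl⟩

end Walk

/-! ### From weighted permutations to 2-matchings -/

section ArcMatching

variable {V : Type*} [Fintype V] [DecidableEq V] {G : SimpleGraph V} [DecidableRel G.Adj]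
  {τ : Equiv.Perm V} {w : V → ℕ}

/-- Transport of weights from the arcs `v → τ v` to edges. -/
def arcWeight (τ : Equiv.Perm V) (w : V → ℕ) (e : Sym2 V) : ℕ :=
  ∑ v with s(v, τ v) = e, w v

theorem sum_arcs_incident (hτ : ∀ v, G.Adj v (τ v)) (a : V) :
    ∑ v with a ∈ s(v, τ v), w v = w a + w (τ.symm a) := by
  have h : a ≠ τ.symm a := fun h => (hτ a).ne ((Equiv.symm_apply_eq τ).1 h.symm)
  rw [← Finset.sum_pair h]
  refine Finset.sum_congr ?_ fun _ _ => rfl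
  ext v
  simp [Equiv.eq_symm_apply, eq_comm]

/-- The arcs over an edge at `a` are among the two arcs entering and leaving `a`, whose weights add
up to 2. Hence `Fin.ofNat 3` in `arcMatching` never wraps around. -/
theorem arcWeight_le_two (hτ : ∀ v, G.Adj v (τ v)) (hw : ∀ v, w v + w (τ v) = 2) (e : Sym2 V) :
    arcWeight τ w e ≤ 2 := by
  induction e with | _ a b
  have h := hw (τ.symm a)
  rw [Equiv.apply_symm_apply, add_comm] at h
  rw [← h, ← sum_arcs_incident hτ, arcWeight]
  refine Finset.sum_le_sum_of_subset fun v hv => ?_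
  simp only [Finset.mem_filter, Finset.mem_univ, true_and] at hv ⊢
  rw [hv]
  exact Sym2.mem_mk_left a b

/-- The 2-matching given by the arcs of `τ` with weights `w`. -/
def arcMatching (G : SimpleGraph V) (τ : Equiv.Perm V) (w : V → ℕ) : G.edgeSet → Fin 3 :=
  fun e => Fin.ofNat 3 (arcWeight τ w e)

theorem val_arcMatching (hτ : ∀ v, G.Adj v (τ v)) (hw : ∀ v, w v + w (τ v) = 2) (e : G.edgeSet) :
    (arcMatching G τ w e : ℕ) = arcWeight τ w e := by
  have := arcWeight_le_two hτ hw e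
  simp only [arcMatching, Fin.ofNat]
  exact Nat.mod_eq_of_lt (by omega)

theorem sum_arcWeight (hτ : ∀ v, G.Adj v (τ v)) (p : Sym2 V → Prop) [DecidablePred p] :
    ∑ e : G.edgeSet with p e.1, arcWeight τ w e = ∑ v with p s(v, τ v), w v := by
  simp only [arcWeight, Finset.sum_filter]
  rw [Finset.sum_congr rfl (fun e _ => (by split_ifs <;> simp :
    (if p e.1 then ∑ v, (if s(v, τ v) = e.1 then w v else 0) else 0) =
      ∑ v, if p e.1 then (if s(v, τ v) = e.1 then w v else 0) else 0)), Finset.sum_comm]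
  refine Finset.sum_congr rfl fun v _ => ?_
  rw [Finset.sum_eq_single (⟨s(v, τ v), hτ v⟩ : G.edgeSet)]
  · simp
  · intro e _ he
    rw [if_neg (fun h : s(v, τ v) = e.1 => he (Subtype.ext h.symm))]
    simp
  · simp

theorem isTwoMatching_arcMatching (hτ : ∀ v, G.Adj v (τ v)) (hw : ∀ v, w v + w (τ v) = 2) :
    IsTwoMatching G (arcMatching G τ w) := by
  intro v
  simp only [nodeSum, val_arcMatching hτ hw]
  rw [sum_arcWeight hτ (fun e => v ∈ e), sum_arcs_incident hτ, add_comm]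
  have h := hw (τ.symm v)
  rw [Equiv.apply_symm_apply] at h
  exact h.le

theorem isPerfect_arcMatching (hτ : ∀ v, G.Adj v (τ v)) (hw : ∀ v, w v + w (τ v) = 2) :
    IsPerfect G (arcMatching G τ w) := by
  simp only [IsPerfect, size, val_arcMatching hτ hw]
  have h1 := sum_arcWeight (w := w) hτ (fun _ => True)
  simp only [Finset.filter_true] at h1
  rw [h1]
  have h2 : ∑ v, (w v + w (τ v)) = Fintype.card V * 2 := by simp [hw]
  rw [Finset.sum_add_distrib, Equiv.sum_comp τ w] at h2
  omega

theorem exists_arc_of_arcMatching_ne_zero (hτ : ∀ v, G.Adj v (τ v))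
    (hw : ∀ v, w v + w (τ v) = 2) {e : G.edgeSet} (h : arcMatching G τ w e ≠ 0) :
    ∃ v, s(v, τ v) = e.1 ∧ w v ≠ 0 := by
  have h1 : arcWeight τ w e ≠ 0 := by
    rw [← val_arcMatching hτ hw]
    exact fun h0 => h (Fin.ext h0)
  obtain ⟨v, hv, h2⟩ := Finset.exists_ne_zero_of_sum_ne_zero h1
  exact ⟨v, by simpa using hv, h2⟩

/-- Every support edge carries an arc of `τ`. One arc leaves and one enters each node, so arcs on
all three sides of a triangle must be cyclically oriented, giving an orbit of size three. -/
theorem isTriangleFree_arcMatching (hτ : ∀ v, G.Adj v (τ v)) (hw : ∀ v, w v + w (τ v) = 2)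
    (h3 : ∀ v, τ (τ (τ v)) ≠ v) : IsTriangleFree G (arcMatching G τ w) := by
  have key : ∀ a b, (supp G (arcMatching G τ w)).Adj a b → τ a = b ∨ τ b = a := by
    intro a b h
    rw [supp, fromEdgeSet_adj] at h
    obtain ⟨⟨h1, h2⟩, -⟩ := h
    obtain ⟨v, hv, -⟩ := exists_arc_of_arcMatching_ne_zero hτ hw h2
    rw [Sym2.eq_iff] at hv
    rcases hv with ⟨rfl, rfl⟩ | ⟨rfl, rfl⟩ <;> simp
  intro s hs
  rw [is3Clique_iff] at hs
  obtain ⟨a, b, c, hab, hac, hbc, -⟩ := hs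
  have n1 := hab.ne
  have n2 := hac.ne
  have n3 := hbc.ne
  rcases key _ _ hab with h1 | h1 <;> rcases key _ _ hac with h2 | h2 <;>
    rcases key _ _ hbc with h4 | h4
  · exact n3 (h1.symm.trans h2)
  · exact n3 (h1.symm.trans h2)
  · exact h3 a (by rw [h1, h4, h2])
  · exact n1 (h2.symm.trans h4)
  · exact n2 (h1.symm.trans h4)
  · exact h3 a (by rw [h2, h4, h1])
  · exact n2 (h1.symm.trans h4)
  · exact n3 (τ.injective (h1.trans h2.symm))

theorem isBasic_arcMatching (hτ : ∀ v, G.Adj v (τ v)) (hw : ∀ v, w v + w (τ v) = 2)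
    (hodd : ∀ v, w v = 1 ↔ Odd (Function.minimalPeriod τ v)) :
    IsBasic G (arcMatching G τ w) := by
  have hone : ∀ e : G.edgeSet, arcMatching G τ w e = 1 ↔
      ∃ v, s(v, τ v) = e.1 ∧ Odd (Function.minimalPeriod τ v) := by
    intro e
    constructor
    · intro h
      have h1 : arcWeight τ w e = 1 := by rw [← val_arcMatching hτ hw, h]; rfl
      obtain ⟨v, hv, hv0⟩ := exists_arc_of_arcMatching_ne_zero hτ hw (e := e) (by rw [h]; decide)
      refine ⟨v, hv, (hodd v).1 ?_⟩
      have : w v ≤ arcWeight τ w e :=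
        Finset.single_le_sum (f := w) (fun _ _ => Nat.zero_le _) (by simpa using hv)
      omega
    · rintro ⟨v, hv, h⟩
      -- A 2-cycle is an even orbit; hence an edge of an odd orbit carries only one arc, and its
      -- weight is exactly 1.
      have h2 : τ (τ v) ≠ v := by
        intro h2
        have hdvd : Function.minimalPeriod τ v ∣ 2 := Function.IsPeriodicPt.minimalPeriod_dvd h2
        rcases (Nat.dvd_prime Nat.prime_two).1 hdvd with h4 | h4
        · exact (hτ v).ne (Function.minimalPeriod_eq_one_iff_isFixedPt.1 h4).symm
        · rw [h4] at h; exact absurd h (by decide)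
      have h3 : arcWeight τ w e = 1 := by
        rw [← (hodd v).2 h, arcWeight]
        have : (Finset.univ.filter fun u => s(u, τ u) = e.1) = {v} := by
          ext u
          simp only [Finset.mem_filter, Finset.mem_univ, true_and, Finset.mem_singleton, ← hv,
            Sym2.eq_iff]
          constructor
          · rintro (⟨h5, -⟩ | ⟨rfl, h5⟩)
            · exact h5
            · exact absurd h5 h2
          · rintro rfl; simp
        rw [this, Finset.sum_singleton]
      rw [Fin.ext_iff, val_arcMatching hτ hw, h3]
      rfl
  refine ⟨{C | ∃ v, Odd (Function.minimalPeriod τ v) ∧ C = orbitSubgraph hτ v}, ?_, ?_, ?_⟩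
  · rintro C ⟨v, hv, rfl⟩
    exact isOddCircuit_orbitSubgraph hτ v hv
  · rintro C ⟨v, hv, rfl⟩ D ⟨u, hu, rfl⟩ hne
    rw [Function.onFun, Set.disjoint_left]
    intro a (ha : τ.SameCycle v a) (hb : τ.SameCycle u a)
    refine hne ?_
    have hvu : τ.SameCycle v u := ha.trans hb.symm
    ext x y
    · exact ⟨fun h => hvu.symm.trans h, fun h => hvu.trans h⟩
    · exact ⟨fun h => ⟨hvu.symm.trans h.1, h.2⟩, fun h => ⟨hvu.trans h.1, h.2⟩⟩
  · ext e
    simp only [Set.mem_ofPred_eq, Set.mem_iUnion, exists_prop]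
    constructor
    · rintro ⟨he, h⟩
      obtain ⟨v, rfl, hv⟩ := (hone _).1 h
      exact ⟨_, ⟨v, hv, rfl⟩, Equiv.Perm.SameCycle.refl τ v, Or.inl rfl⟩
    · rintro ⟨C, ⟨v, hv, rfl⟩, h⟩
      refine ⟨Subgraph.edgeSet_subset _ h, ?_⟩
      rw [hone]
      induction e with | _ a b
      obtain ⟨ha, h⟩ : τ.SameCycle v a ∧ (τ a = b ∨ τ b = a) := h
      rcases h with rfl | rfl
      · exact ⟨a, rfl, by rwa [minimalPeriod_eq_of_sameCycle ha]⟩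
      · refine ⟨b, Sym2.eq_swap, ?_⟩
        rwa [minimalPeriod_eq_of_sameCycle (Equiv.Perm.sameCycle_apply_right.1 ha)]

end ArcMatching

/-! ### Recovering the permutation from its pair of 2-matchings -/

section Fiber

variable {V : Type*} [Fintype V] [DecidableEq V] {G : SimpleGraph V} [DecidableRel G.Adj]
  {τ σ : Equiv.Perm V}

/-- An alternating colouring of the even orbits in which all roots have colour `true`. -/
noncomputable def orbitColor (τ : Equiv.Perm V) : V → Bool := (exists_alternating τ).choose

theorem orbitColor_apply {v : V} (hv : Even (Function.minimalPeriod τ v)) :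
    orbitColor τ (τ v) = !orbitColor τ v :=
  (exists_alternating τ).choose_spec.1 v hv

theorem orbitColor_root (v : V) : orbitColor τ (orbitRoot τ v) = true :=
  (exists_alternating τ).choose_spec.2 v

/-- Weight one on odd orbits, and two on the nodes of colour `b` in even orbits. -/
noncomputable def orbitWeight (τ : Equiv.Perm V) (b : Bool) (v : V) : ℕ :=
  if Odd (Function.minimalPeriod τ v) then 1 else if orbitColor τ v = b then 2 else 0

theorem orbitWeight_add_apply (b : Bool) (v : V) :
    orbitWeight τ b v + orbitWeight τ b (τ v) = 2 := by
  unfold orbitWeight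
  rw [minimalPeriod_map]
  split_ifs with h1 h2 h3 h3
  · rfl
  · rw [orbitColor_apply (Nat.not_odd_iff_even.1 h1), h2] at h3; simp at h3
  · rfl
  · rfl
  · rw [orbitColor_apply (Nat.not_odd_iff_even.1 h1)] at h3
    cases b <;> simp_all

theorem orbitWeight_eq_one (b : Bool) (v : V) :
    orbitWeight τ b v = 1 ↔ Odd (Function.minimalPeriod τ v) := by
  unfold orbitWeight
  split_ifs <;> simp_all

theorem orbitWeight_true_add_false (v : V) :
    orbitWeight τ true v + orbitWeight τ false v = 2 := by
  unfold orbitWeight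
  split_ifs <;> simp_all

theorem arcWeight_one {a b : V} (h : a ≠ b) : arcWeight τ (fun _ => 1) s(a, b) =
    (if τ a = b then 1 else 0) + if τ b = a then 1 else 0 := by
  have h1 : ∀ v, (if s(v, τ v) = s(a, b) then 1 else 0) =
      (if v = a then (if τ a = b then 1 else 0) else 0) +
        if v = b then (if τ b = a then 1 else 0) else 0 := by
    intro v
    rcases eq_or_ne v a with rfl | ha
    · simp [h]
    · rcases eq_or_ne v b with rfl | hb
      · simp [ha]
      · simp [ha, hb]
  simp only [arcWeight, Finset.sum_filter, h1, Finset.sum_add_distrib, Finset.sum_ite_eq',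
    Finset.mem_univ, if_true]

/-- The permutations `τ` and `σ` use every edge the same number of times. -/
def SameArcs (τ σ : Equiv.Perm V) : Prop :=
  ∀ a b, a ≠ b → ((if τ a = b then 1 else 0) + if τ b = a then 1 else 0 : ℕ) =
    (if σ a = b then 1 else 0) + if σ b = a then 1 else 0

/-- The two weightings of a permutation add up to 2 on every arc, so the sum of the pair is twice
the number of arcs over each edge. -/
theorem SameArcs.of_arcMatching (hτ : ∀ v, G.Adj v (τ v)) (hσ : ∀ v, G.Adj v (σ v))
    (h : ∀ b, arcMatching G τ (orbitWeight τ b) = arcMatching G σ (orbitWeight σ b)) :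
    SameArcs τ σ := by
  intro a b hab
  have hw : ∀ b e, e ∈ G.edgeSet →
      arcWeight τ (orbitWeight τ b) e = arcWeight σ (orbitWeight σ b) e := fun b e he => by
    rw [← val_arcMatching hτ (orbitWeight_add_apply b) ⟨e, he⟩, h b,
      val_arcMatching hσ (orbitWeight_add_apply b)]
  have hone : ∀ ρ : Equiv.Perm V, arcWeight ρ (orbitWeight ρ true) s(a, b) +
      arcWeight ρ (orbitWeight ρ false) s(a, b) = 2 * arcWeight ρ (fun _ => 1) s(a, b) := by
    intro ρ
    simp only [arcWeight, ← Finset.sum_add_distrib, orbitWeight_true_add_false, Finset.mul_sum, mul_one]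
  by_cases hG : G.Adj a b
  · have h1 := hone τ
    rw [hw _ _ hG, hw _ _ hG, hone σ, arcWeight_one hab, arcWeight_one hab] at h1
    omega
  · have h1 : ∀ ρ : Equiv.Perm V, (∀ v, G.Adj v (ρ v)) → ρ a ≠ b ∧ ρ b ≠ a := by
      rintro ρ hρ
      exact ⟨fun h => hG (h ▸ hρ a), fun h => hG (h ▸ hρ b).symm⟩
    simp [h1 τ hτ, h1 σ hσ]

theorem SameArcs.symm (h : SameArcs τ σ) : SameArcs σ τ := fun a b hab => (h a b hab).symm

/-- The edge from `v` to `σ v` must also carry an arc of `τ`, and only the reverse direction is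
left. -/
theorem SameArcs.apply_apply_of_ne (h : SameArcs τ σ) {v : V} (hv : σ v ≠ v)
    (hne : τ v ≠ σ v) : τ (σ v) = v := by
  have := h v (σ v) hv.symm
  by_contra h2
  simp [hne, h2] at this
  omega

/-- Agreement propagates along `σ`. A disagreement at `σ v` would make `τ` send both `v` and `σ (σ
v)` to `σ v`, forcing a 2-cycle of `σ`; its edge carries two arcs, so `τ` would agree there after
all. -/
theorem SameArcs.apply_apply_of_eq (h : SameArcs τ σ) {v : V} (hv : ∀ v, σ v ≠ v)
    (heq : τ v = σ v) : τ (σ v) = σ (σ v) := by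
  by_contra h2
  have h3 := h.apply_apply_of_ne (hv _) h2
  have h4 : σ (σ v) = v := τ.injective (h3.trans heq.symm)
  have := h v (σ v) (hv v).symm
  rw [h4] at h2
  simp [heq, h2, h4] at this

theorem SameArcs.eq_of_sameCycle (h : SameArcs τ σ) (hσ : ∀ v, σ v ≠ v) {v u : V}
    (hvu : σ.SameCycle v u) (heq : τ v = σ v) : τ u = σ u := by
  obtain ⟨i, rfl⟩ := hvu.exists_nat_pow_eq
  induction i with
  | zero => simpa using heq
  | succ i ih =>
    rw [pow_succ', Equiv.Perm.mul_apply]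
    exact h.apply_apply_of_eq hσ (ih ⟨i, by simp⟩)

theorem SameArcs.apply_eq_or (h : SameArcs τ σ) (hσ : ∀ v, σ v ≠ v) (v : V) :
    τ v = σ v ∨ τ v = σ.symm v := by
  by_cases hv : τ v = σ v
  · exact Or.inl hv
  · right
    have h1 : τ (σ.symm v) ≠ σ (σ.symm v) := fun h2 => hv
      (h.eq_of_sameCycle hσ (by simpa using (Equiv.Perm.sameCycle_apply_right (f := σ)
        (x := σ.symm v) (y := σ.symm v)).2 (Equiv.Perm.SameCycle.refl σ _)) h2)
    simpa using h.apply_apply_of_ne (hσ _) h1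

theorem SameArcs.orbitFinset_subset (h : SameArcs τ σ) (hσ : ∀ v, σ v ≠ v) (v : V) :
    orbitFinset τ v ⊆ orbitFinset σ v := by
  intro u hu
  obtain ⟨i, rfl⟩ := (mem_orbitFinset.1 hu).exists_nat_pow_eq
  clear hu
  induction i with
  | zero => exact self_mem_orbitFinset v
  | succ i ih =>
    rw [pow_succ', Equiv.Perm.mul_apply]
    rcases h.apply_eq_or hσ ((τ ^ i) v) with h1 | h1
    · rw [h1, apply_mem_orbitFinset]; exact ih
    · rw [h1, ← apply_mem_orbitFinset, Equiv.apply_symm_apply]; exact ih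

/-- On an even orbit, the first matching has weight 2 on the edge along which `σ` leaves the root.
If `τ` traversed the orbit backwards, its arc over that edge would end at the common root and start
at a node of colour `false`, with weight 0. -/
theorem apply_eq_of_even (hτ : ∀ v, G.Adj v (τ v)) (hσ : ∀ v, G.Adj v (σ v))
    (h : ∀ b, arcMatching G τ (orbitWeight τ b) = arcMatching G σ (orbitWeight σ b)) {v : V}
    (hv : Even (Function.minimalPeriod σ v)) : τ v = σ v := by
  have hs := SameArcs.of_arcMatching hτ hσ h
  have hτ' : ∀ v, τ v ≠ v := fun v => (hτ v).ne'
  have hσ' : ∀ v, σ v ≠ v := fun v => (hσ v).ne'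
  have horb : orbitFinset τ v = orbitFinset σ v :=
    (hs.orbitFinset_subset hσ' v).antisymm (hs.symm.orbitFinset_subset hτ' v)
  have hroot := orbitRoot_eq horb
  by_contra hne
  set r := orbitRoot σ v with hr
  have hrσ : σ.SameCycle v r := mem_orbitFinset.1 (orbitRoot_mem v)
  have hrτ : τ.SameCycle v r := by rw [← hroot]; exact mem_orbitFinset.1 (orbitRoot_mem v)
  have hner : τ r ≠ σ r := fun h1 => hne (hs.eq_of_sameCycle hσ' hrσ.symm h1)
  have hback := hs.apply_apply_of_ne (hσ' r) hner
  have hpσ : ¬ Odd (Function.minimalPeriod σ r) := by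
    rwa [minimalPeriod_eq_of_sameCycle hrσ, Nat.not_odd_iff_even]
  have hpτ : Even (Function.minimalPeriod τ (σ r)) := by
    rw [← minimalPeriod_map, hback, minimalPeriod_eq_of_sameCycle hrτ, ← card_orbitFinset, horb,
      card_orbitFinset]
    exact hv
  have hcol : orbitColor τ (σ r) = false := by
    have h1 := orbitColor_apply hpτ
    have h2 : orbitColor τ r = true := by rw [← hroot]; exact orbitColor_root v
    rw [hback, h2] at h1
    simpa using h1.symm
  have h2 : 2 ≤ arcWeight σ (orbitWeight σ true) s(r, σ r) := by
    have h3 : orbitWeight σ true r = 2 := by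
      rw [orbitWeight, if_neg hpσ, if_pos (orbitColor_root v)]
    rw [← h3]
    exact Finset.single_le_sum (f := orbitWeight σ true) (fun _ _ => Nat.zero_le _) (by simp)
  have h3 : arcWeight τ (orbitWeight τ true) s(r, σ r) = 0 := by
    refine Finset.sum_eq_zero fun u hu => ?_
    simp only [Finset.mem_filter, Finset.mem_univ, true_and, Sym2.eq_iff] at hu
    rcases hu with ⟨rfl, h4⟩ | ⟨rfl, -⟩
    · exact absurd h4 hner
    · rw [orbitWeight, if_neg (Nat.not_odd_iff_even.2 hpτ), hcol]; simp
  rw [← val_arcMatching hτ (orbitWeight_add_apply true) ⟨s(r, σ r), hσ r⟩, h,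
    val_arcMatching hσ (orbitWeight_add_apply true)] at h3
  exact absurd (h2.trans_eq h3) (by norm_num)

/-- The orbits of odd size. -/
noncomputable def oddOrbits (τ : Equiv.Perm V) : Finset (Finset V) :=
  (Finset.univ.image (orbitFinset τ)).filter fun O => Odd O.card

/-- The pair of 2-matchings that a permutation decomposes into. -/
noncomputable def arcMatchingPair (G : SimpleGraph V) (τ : Equiv.Perm V) :
    (G.edgeSet → Fin 3) × (G.edgeSet → Fin 3) :=
  (arcMatching G τ (orbitWeight τ true), arcMatching G τ (orbitWeight τ false))

/-- A member of the fibre follows or reverses each orbit of `σ` and follows all even ones, so it is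
encoded by the set of odd orbits on which it agrees with `σ`. -/
theorem card_fiber_le {P : Finset (Equiv.Perm V)} (hP : ∀ τ ∈ P, ∀ v, G.Adj v (τ v))
    (hσ : σ ∈ P) : (P.filter fun τ => arcMatchingPair G τ = arcMatchingPair G σ).card ≤
      2 ^ (oddOrbits σ).card := by
  rw [← Finset.card_powerset]
  have hpair : ∀ τ ∈ P.filter (fun τ => arcMatchingPair G τ = arcMatchingPair G σ),
      (∀ v, G.Adj v (τ v)) ∧
        ∀ b, arcMatching G τ (orbitWeight τ b) = arcMatching G σ (orbitWeight σ b) := by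
    intro τ hτ
    rw [Finset.mem_filter] at hτ
    refine ⟨hP τ hτ.1, fun b => ?_⟩
    cases b
    · exact (Prod.ext_iff.1 hτ.2).2
    · exact (Prod.ext_iff.1 hτ.2).1
  have hσ' : ∀ v, σ v ≠ v := fun v => (hP σ hσ v).ne'
  refine Finset.card_le_card_of_injOn
    (fun τ => (oddOrbits σ).filter fun O => ∀ v ∈ O, τ v = σ v)
    (fun τ _ => Finset.mem_coe.2 (Finset.mem_powerset.2 (Finset.filter_subset _ _))) ?_
  intro τ hτ ρ hρ heq
  obtain ⟨hτ1, hτ2⟩ := hpair τ hτ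
  obtain ⟨hρ1, hρ2⟩ := hpair ρ hρ
  have hsτ := SameArcs.of_arcMatching hτ1 (hP σ hσ) hτ2
  have hsρ := SameArcs.of_arcMatching hρ1 (hP σ hσ) hρ2
  ext v
  by_cases hv : Odd (Function.minimalPeriod σ v)
  · have hO : orbitFinset σ v ∈ oddOrbits σ := by
      simp [oddOrbits, card_orbitFinset, hv]
    have hiff : ∀ κ, SameArcs κ σ →
        (κ v = σ v ↔ orbitFinset σ v ∈ (oddOrbits σ).filter fun O => ∀ v ∈ O, κ v = σ v) := by
      intro κ hκ
      rw [Finset.mem_filter]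
      exact ⟨fun h => ⟨hO, fun u hu => hκ.eq_of_sameCycle hσ' (mem_orbitFinset.1 hu) h⟩,
        fun h => h.2 v (self_mem_orbitFinset v)⟩
    have hiff2 : τ v = σ v ↔ ρ v = σ v := by
      rw [hiff τ hsτ, hiff ρ hsρ]
      simp only at heq
      rw [heq]
    rcases hsτ.apply_eq_or hσ' v with h1 | h1
    · rw [h1, hiff2.1 h1]
    · rcases hsρ.apply_eq_or hσ' v with h2 | h2
      · rw [h2, hiff2.2 h2]
      · rw [h1, h2]
  · rw [Nat.not_odd_iff_even] at hv
    rw [apply_eq_of_even hτ1 (hP σ hσ) hτ2 hv, apply_eq_of_even hρ1 (hP σ hσ) hρ2 hv]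

/-- Basic perfect triangle-free 2-matchings. -/
def goodMatchings (G : SimpleGraph V) [DecidableRel G.Adj] : Set (G.edgeSet → Fin 3) :=
  {x | IsTwoMatching G x ∧ IsBasic G x ∧ IsPerfect G x ∧ IsTriangleFree G x}

theorem arcMatching_mem_goodMatchings (hτ : ∀ v, G.Adj v (τ v)) (h3 : ∀ v, τ (τ (τ v)) ≠ v)
    (b : Bool) : arcMatching G τ (orbitWeight τ b) ∈ goodMatchings G :=
  ⟨isTwoMatching_arcMatching hτ (orbitWeight_add_apply b),
    isBasic_arcMatching hτ (orbitWeight_add_apply b) (orbitWeight_eq_one b),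
    isPerfect_arcMatching hτ (orbitWeight_add_apply b),
    isTriangleFree_arcMatching hτ (orbitWeight_add_apply b) h3⟩

theorem card_le_two_pow_mul_sq (P : Finset (Equiv.Perm V)) (hP : ∀ τ ∈ P, ∀ v, G.Adj v (τ v))
    (h3 : ∀ τ ∈ P, ∀ v, τ (τ (τ v)) ≠ v) (k : ℕ) (hk : ∀ τ ∈ P, (oddOrbits τ).card ≤ k) :
    P.card ≤ 2 ^ k * (goodMatchings G).ncard ^ 2 := by
  classical
  have h1 : P.card ≤ 2 ^ k * (P.image (arcMatchingPair G)).card := by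
    refine Finset.card_le_mul_card_image P _ fun x hx => ?_
    obtain ⟨σ, hσ, rfl⟩ := Finset.mem_image.1 hx
    exact (card_fiber_le hP hσ).trans (Nat.pow_le_pow_right two_pos (hk σ hσ))
  refine h1.trans (Nat.mul_le_mul_left _ ?_)
  rw [sq, Set.ncard_eq_toFinset_card', ← Finset.card_product]
  refine Finset.card_le_card fun x hx => ?_
  obtain ⟨σ, hσ, rfl⟩ := Finset.mem_image.1 hx
  simp only [Finset.mem_product, Set.mem_toFinset]
  exact ⟨arcMatching_mem_goodMatchings (hP σ hσ) (h3 σ hσ) true,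
    arcMatching_mem_goodMatchings (hP σ hσ) (h3 σ hσ) false⟩

end Fiber

/-! ### Contracting a maximal family of disjoint triangles -/

section Rotation

variable {V : Type*} [Fintype V] [DecidableEq V] {G : SimpleGraph V} [DecidableRel G.Adj]

/-- A permutation rotating the triangles of a family of disjoint triangles, and fixing all other
nodes. -/
structure IsTriangleRotation (G : SimpleGraph V) (ρ : Equiv.Perm V) : Prop where
  cube : ∀ v, ρ (ρ (ρ v)) = v
  adj : ∀ v, ρ v ≠ v → G.Adj v (ρ v)

theorem exists_maximal_triangleRotation (G : SimpleGraph V) :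
    ∃ ρ : Equiv.Perm V, IsTriangleRotation G ρ ∧
      ∀ a b c, G.Adj a b → G.Adj b c → G.Adj c a → ρ a ≠ a ∨ ρ b ≠ b ∨ ρ c ≠ c := by
  classical
  obtain ⟨ρ, hρ, hmax⟩ := (Finset.univ.filter fun ρ : Equiv.Perm V =>
    IsTriangleRotation G ρ).exists_max_image (fun ρ => ρ.support.card)
    ⟨1, by simp only [Finset.mem_filter, Finset.mem_univ, true_and]; exact ⟨by simp, by simp⟩⟩
  simp only [Finset.mem_filter, Finset.mem_univ, true_and] at hρ hmax
  refine ⟨ρ, hρ, fun a b c hab hbc hca => ?_⟩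
  by_contra hcon
  push Not at hcon
  obtain ⟨ha, hb, hc⟩ := hcon
  have n1 := hab.ne
  have n2 := hbc.ne
  have n3 := hca.ne
  -- The 3-cycle a → b → c → a is disjoint from `ρ`, so composing with it would enlarge the support.
  let κ : Equiv.Perm V := Equiv.swap a b * Equiv.swap b c
  have κa : κ a = b := by
    simp [κ, Equiv.swap_apply_of_ne_of_ne n1 n3.symm]
  have κb : κ b = c := by
    simp [κ, Equiv.swap_apply_of_ne_of_ne n3 n2.symm]
  have κc : κ c = a := by simp [κ]
  have κo : ∀ v, v ≠ a → v ≠ b → v ≠ c → κ v = v := fun v h1 h2 h3 => by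
    simp [κ, Equiv.swap_apply_of_ne_of_ne h2 h3, Equiv.swap_apply_of_ne_of_ne h1 h2]
  have ρo : ∀ v, v ≠ a → v ≠ b → v ≠ c → ρ v ≠ a ∧ ρ v ≠ b ∧ ρ v ≠ c := fun v h1 h2 h3 =>
    ⟨fun h => h1 (ρ.injective (h.trans ha.symm)), fun h => h2 (ρ.injective (h.trans hb.symm)),
      fun h => h3 (ρ.injective (h.trans hc.symm))⟩
  have κρ : ∀ v, v ≠ a → v ≠ b → v ≠ c → κ (ρ v) = ρ v := fun v h1 h2 h3 =>
    κo _ (ρo v h1 h2 h3).1 (ρo v h1 h2 h3).2.1 (ρo v h1 h2 h3).2.2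
  have hnew : IsTriangleRotation G (κ * ρ) := by
    constructor
    · intro v
      simp only [Equiv.Perm.mul_apply]
      by_cases h1 : v = a
      · subst h1; simp [ha, hb, hc, κa, κb, κc]
      by_cases h2 : v = b
      · subst h2; simp [ha, hb, hc, κa, κb, κc]
      by_cases h3 : v = c
      · subst h3; simp [ha, hb, hc, κa, κb, κc]
      obtain ⟨h4, h5, h6⟩ := ρo v h1 h2 h3
      obtain ⟨h7, h8, h9⟩ := ρo _ h4 h5 h6
      rw [κρ v h1 h2 h3, κρ _ h4 h5 h6, κρ _ h7 h8 h9, hρ.cube]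
    · intro v
      simp only [Equiv.Perm.mul_apply]
      by_cases h1 : v = a
      · subst h1; simp [ha, κa, hab]
      by_cases h2 : v = b
      · subst h2; simp [hb, κb, hbc]
      by_cases h3 : v = c
      · subst h3; simp [hc, κc, hca]
      rw [κρ v h1 h2 h3]
      exact hρ.adj v
  have hlt : ρ.support.card < (κ * ρ).support.card := by
    refine Finset.card_lt_card (Finset.ssubset_iff_of_subset ?_ |>.2 ⟨a, ?_, ?_⟩)
    · intro v hv
      rw [Equiv.Perm.mem_support] at hv ⊢
      rw [Equiv.Perm.mul_apply, κρ]
      · exact hv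
      · rintro rfl; exact hv ha
      · rintro rfl; exact hv hb
      · rintro rfl; exact hv hc
    · rw [Equiv.Perm.mem_support, Equiv.Perm.mul_apply, ha, κa]
      exact n1.symm
    · rw [Equiv.Perm.mem_support]; simp [ha]
  exact absurd (hmax _ hnew) (not_le.2 hlt)

variable {ρ : Equiv.Perm V}

theorem IsTriangleRotation.adj_sq (h : IsTriangleRotation G ρ) {v : V} (hv : ρ v ≠ v) :
    G.Adj v (ρ (ρ v)) := by
  have h1 := h.adj (ρ (ρ v)) (by rw [h.cube]; intro h2; exact hv (by
    have := congrArg ρ h2; rw [h.cube] at this; exact this))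
  rw [h.cube] at h1
  exact h1.symm

theorem IsTriangleRotation.sq_ne (h : IsTriangleRotation G ρ) {v : V} (hv : ρ v ≠ v) :
    ρ (ρ v) ≠ v ∧ ρ (ρ v) ≠ ρ v :=
  ⟨(h.adj_sq hv).ne', fun h1 => hv (ρ.injective h1)⟩

/-- The fibres of `cls` are the rotated triangles and the fixed nodes. -/
structure IsContraction {N : Type*} (G : SimpleGraph V) (ρ : Equiv.Perm V) (cls : V → N) :
    Prop where
  rot : IsTriangleRotation G ρ
  cls_eq : ∀ v w, cls v = cls w ↔ w = v ∨ w = ρ v ∨ w = ρ (ρ v)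
  surj : Function.Surjective cls

variable {N : Type*} [Fintype N] [DecidableEq N] {cls : V → N}

namespace IsContraction

variable (h : IsContraction G ρ cls)
include h

theorem cls_rot (v : V) : cls (ρ v) = cls v := ((h.cls_eq _ _).2 (Or.inr (Or.inl rfl))).symm

theorem filter_cls (v : V) : (Finset.univ.filter fun u => cls u = cls v) = {v, ρ v, ρ (ρ v)} := by
  ext u
  rw [Finset.mem_filter, eq_comm, h.cls_eq]
  simp

theorem sum_cls (v : V) (f : V → ℕ) :
    ∑ u with cls u = cls v, f u =
      if ρ v = v then f v else f v + (f (ρ v) + f (ρ (ρ v))) := by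
  rw [h.filter_cls]
  split_ifs with hv
  · simp [hv]
  · have := h.rot.sq_ne hv
    rw [Finset.sum_insert, Finset.sum_pair this.2.symm]
    simp [Ne.symm hv, this.1.symm]

theorem card_le : Fintype.card V ≤ 3 * Fintype.card N := by
  rw [← Finset.card_univ, ← Finset.card_univ]
  refine Finset.card_le_mul_card_image_of_maps_to (f := cls) (fun _ _ => Finset.mem_univ _) 3 ?_
  intro p _
  obtain ⟨v, rfl⟩ := h.surj p
  rw [h.filter_cls]
  exact Finset.card_le_three

theorem adj_of_cls_eq {v w : V} (hvw : cls v = cls w) (hne : v ≠ w) : G.Adj v w := by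
  rcases (h.cls_eq v w).1 hvw with rfl | rfl | rfl
  · exact absurd rfl hne
  · exact h.rot.adj v hne.symm
  · refine h.rot.adj_sq fun h1 => hne ?_
    rw [h1, h1]

/-- A fixed node is a class by itself, so all three of its edges cross. A rotated node has two of
its three neighbours in its own triangle. -/
theorem card_crossing (hG : G.IsRegularOfDegree 3) (v : V) :
    (Finset.univ.filter fun w => G.Adj v w ∧ cls w ≠ cls v).card = if ρ v = v then 3 else 1 := by
  have h1 : (Finset.univ.filter fun w => G.Adj v w ∧ cls w ≠ cls v) =
      G.neighborFinset v \ {ρ v, ρ (ρ v)} := by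
    ext w
    simp only [Finset.mem_filter, Finset.mem_univ, true_and, Finset.mem_sdiff,
      mem_neighborFinset, Finset.mem_insert, Finset.mem_singleton]
    refine and_congr_right fun hvw => not_congr ?_
    rw [eq_comm, h.cls_eq]
    simp [hvw.ne']
  have h2 : (G.neighborFinset v).card = 3 := hG v
  rw [h1]
  split_ifs with hv
  · rw [Finset.sdiff_eq_self_of_disjoint, h2]
    simp [hv]
  · rw [Finset.card_sdiff_of_subset, h2, Finset.card_pair (h.rot.sq_ne hv).2.symm]
    intro w hw
    simp only [Finset.mem_insert, Finset.mem_singleton] at hw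
    rw [mem_neighborFinset]
    rcases hw with rfl | rfl
    · exact h.rot.adj v hv
    · exact h.rot.adj_sq hv

end IsContraction

/-- The arcs of `G` from the class `p` to another class `q`. -/
def crossingArcs (G : SimpleGraph V) [DecidableRel G.Adj] (cls : V → N) (p q : N) :
    Finset (V × V) :=
  Finset.univ.filter fun d => G.Adj d.1 d.2 ∧ cls d.1 = p ∧ cls d.2 = q ∧ q ≠ p

theorem mem_crossingArcs {p q : N} {d : V × V} :
    d ∈ crossingArcs G cls p q ↔ G.Adj d.1 d.2 ∧ cls d.1 = p ∧ cls d.2 = q ∧ q ≠ p := by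
  simp [crossingArcs]

theorem card_crossingArcs_comm (p q : N) :
    (crossingArcs G cls p q).card = (crossingArcs G cls q p).card := by
  refine Finset.card_bij' (fun d _ => d.swap) (fun d _ => d.swap) ?_ ?_ (fun _ _ => rfl)
    (fun _ _ => rfl) <;>
  · rintro ⟨u, v⟩ hd
    rw [mem_crossingArcs] at hd ⊢
    exact ⟨hd.1.symm, hd.2.2.1, hd.2.1, hd.2.2.2.symm⟩

theorem IsContraction.sum_card_crossingArcs (h : IsContraction G ρ cls)
    (hG : G.IsRegularOfDegree 3) (p : N) : ∑ q, (crossingArcs G cls p q).card = 3 := by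
  obtain ⟨v, rfl⟩ := h.surj p
  have h1 : ∑ q, (crossingArcs G cls (cls v) q).card =
      ∑ u with cls u = cls v, (Finset.univ.filter fun w => G.Adj u w ∧ cls w ≠ cls u).card := by
    rw [← Finset.card_sigma, ← Finset.card_sigma]
    refine Finset.card_bij' (fun x _ => ⟨x.2.1, x.2.2⟩) (fun x _ => ⟨cls x.2, (x.1, x.2)⟩)
      ?_ ?_ ?_ ?_
    · rintro ⟨q, u, w⟩ hx
      simp only [Finset.mem_sigma, Finset.mem_univ, true_and, mem_crossingArcs,
        Finset.mem_filter] at hx ⊢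
      obtain ⟨h1, h2, rfl, h3⟩ := hx
      exact ⟨h2, h1, by rwa [h2]⟩
    · rintro ⟨u, w⟩ hx
      simp only [Finset.mem_sigma, Finset.mem_univ, true_and, mem_crossingArcs,
        Finset.mem_filter] at hx ⊢
      obtain ⟨h1, h2, h3⟩ := hx
      exact ⟨h2, h1, by rwa [← h1]⟩
    · rintro ⟨q, u, w⟩ hx
      simp only [Finset.mem_sigma, Finset.mem_univ, true_and, mem_crossingArcs] at hx
      obtain ⟨h1, h2, rfl, h3⟩ := hx
      rfl
    · rintro ⟨u, w⟩ hx
      rfl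
  rw [h1, h.sum_cls]
  simp only [h.card_crossing hG]
  by_cases hv : ρ v = v <;> simp [hv]

/-- Rows are indexed by targets and columns by sources, because the products in `Matrix.permanent`
run over the entries at (σ p, p). -/
theorem IsContraction.cubicMatrix (h : IsContraction G ρ cls) (hG : G.IsRegularOfDegree 3) :
    CubicMatrix (Matrix.of fun q p => (crossingArcs G cls p q).card) := by
  refine ⟨fun q => ?_, fun p => h.sum_card_crossingArcs hG p⟩
  rw [← h.sum_card_crossingArcs hG q]
  exact Finset.sum_congr rfl fun p _ => card_crossingArcs_comm p q

end Rotation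

/-! ### Lifting permutations of the classes to permutations of the nodes -/

section Lift

variable {V : Type*} [Fintype V] [DecidableEq V] {G : SimpleGraph V} [DecidableRel G.Adj]
  {ρ : Equiv.Perm V} {N : Type*} [Fintype N] [DecidableEq N] {cls : V → N}

/-- `τ` enters and leaves every class exactly once, at `b p` and `a p`, and induces `σ` on the
classes; inside a class, it joins `b p` to `a p` by a path of even length. -/
structure IsLift (G : SimpleGraph V) (cls : V → N) (a b : N → V) (σ : Equiv.Perm N)
    (τ : Equiv.Perm V) : Prop where
  adj : ∀ v, G.Adj v (τ v)
  exit : ∀ p, τ (a p) = b (σ p)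
  inner : ∀ v, v ≠ a (cls v) → cls (τ v) = cls v
  mem_iff : ∀ O : Finset V, (∀ v, τ v ∈ O ↔ v ∈ O) → ∀ p, b p ∈ O ↔ a p ∈ O
  parity : ∀ O : Finset V, (∀ v, τ v ∈ O ↔ v ∈ O) → ∀ p,
    (∑ v with cls v = p, if v ∈ O then 1 else 0) % 2 = if b p ∈ O then 1 else 0

/-- The permutation of a class inside which `a` is moved to `b`. -/
def classPerm (ρ : Equiv.Perm V) (a b : V) : Equiv.Perm V :=
  if a = b then Equiv.swap (ρ a) (ρ (ρ a)) else if b = ρ a then ρ else ρ * ρ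

/-- In a triangle entered at b and left at a, the lift goes b → third node → a if a ≠ b; if a = b it
passes straight through and swaps the other two nodes. Either way an invariant set contains an odd
number of nodes of the class exactly when it contains b. -/
theorem IsContraction.exists_lift (h : IsContraction G ρ cls) (a b : N → V)
    (ha : ∀ p, cls (a p) = p) (hb : ∀ p, cls (b p) = p) (σ : Equiv.Perm N)
    (hadj : ∀ p, G.Adj (a p) (b (σ p))) : ∃ τ, IsLift G cls a b σ τ := by
  have hρ3 := h.rot.cube
  have hcases : ∀ p v, cls v = p → v = a p ∨ v = ρ (a p) ∨ v = ρ (ρ (a p)) := fun p v hv =>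
    (h.cls_eq _ _).1 ((ha p).trans hv.symm)
  have hclsρ := h.cls_rot
  let f : N → V → V := fun p => classPerm ρ (a p) (b p)
  have hfa : ∀ p, f p (a p) = b p := by
    intro p
    simp only [f, classPerm]
    split_ifs with h1 h2
    · rw [← h1]
      by_cases h3 : ρ (a p) = a p
      · simp [h3]
      · exact Equiv.swap_apply_of_ne_of_ne (Ne.symm h3) (h.rot.sq_ne h3).1.symm
    · exact h2.symm
    · rcases hcases p _ (hb p) with h3 | h3 | h3
      · exact absurd h3.symm h1
      · exact absurd h3 h2
      · exact h3.symm
  have hfcls : ∀ p v, cls v = p → cls (f p v) = p := by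
    intro p v hv
    simp only [f, classPerm]
    split_ifs with h1 h2
    · rw [Equiv.swap_apply_def]
      split_ifs
      · rw [hclsρ, hclsρ, ha]
      · rw [hclsρ, ha]
      · exact hv
    · rw [hclsρ, hv]
    · rw [Equiv.Perm.mul_apply, hclsρ, hclsρ, hv]
  have hfne : ∀ p v, cls v = p → v ≠ a p → f p v ≠ v := by
    intro p v hv hva
    have hnf : ρ v ≠ v := by
      intro h1
      rcases hcases p v hv with h2 | h2 | h2
      · exact hva h2
      · rw [h2] at h1; exact hva (h2.trans (ρ.injective h1))
      · rw [h2, hρ3] at h1; exact hva (h2.trans h1.symm)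
    simp only [f, classPerm]
    split_ifs with h1 h2
    · rcases hcases p v hv with h2 | h2 | h2
      · exact absurd h2 hva
      · rw [h2, Equiv.swap_apply_left]
        rw [h2] at hnf
        exact hnf
      · rw [h2, Equiv.swap_apply_right]
        intro h3
        rw [h2, ← h3] at hnf
        exact hnf h3.symm
    · exact hnf
    · exact (h.rot.sq_ne hnf).1
  -- Each class permutation sends `a p` to `b p`; redirecting `a p` to the entry of the next class
  -- frees `b p` to receive the incoming arc.
  let g : V → V := fun v => if v = a (cls v) then b (σ (cls v)) else f (cls v) v
  have hg1 : ∀ p, g (a p) = b (σ p) := fun p => by simp [g, ha]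
  have hg2 : ∀ v, v ≠ a (cls v) → g v = f (cls v) v := fun v hv => by simp [g, hv]
  have hg3 : ∀ v w, v = a (cls v) → w ≠ a (cls w) → g v ≠ g w := by
    intro v w hv hw heq
    rw [hg2 w hw, hv, hg1] at heq
    have h1 := congrArg cls heq
    rw [hb, hfcls _ _ rfl] at h1
    rw [h1, ← hfa] at heq
    exact hw ((Equiv.injective _ heq).symm)
  have hinj : Function.Injective g := by
    intro v w heq
    by_cases hv : v = a (cls v) <;> by_cases hw : w = a (cls w)
    · rw [hv, hw, hg1, hg1] at heq
      have h1 := congrArg cls heq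
      rw [hb, hb] at h1
      rw [hv, hw, σ.injective h1]
    · exact absurd heq (hg3 v w hv hw)
    · exact absurd heq.symm (hg3 w v hw hv)
    · rw [hg2 v hv, hg2 w hw] at heq
      have h1 := congrArg cls heq
      rw [hfcls _ _ rfl, hfcls _ _ rfl] at h1
      rw [h1] at heq
      exact Equiv.injective _ heq
  let τ : Equiv.Perm V := Equiv.ofBijective g (Finite.injective_iff_bijective.1 hinj)
  have hτg : ∀ v, τ v = g v := fun v => rfl
  have hboth : ∀ O : Finset V, (∀ v, τ v ∈ O ↔ v ∈ O) → ∀ p, (b p ∈ O ↔ a p ∈ O) ∧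
      (∑ v with cls v = p, if v ∈ O then 1 else 0) % 2 = if b p ∈ O then 1 else 0 := by
    intro O hO p
    have hsum := h.sum_cls (a p) (fun v => if v ∈ O then 1 else 0)
    rw [ha] at hsum
    rw [hsum]
    have hstep : ∀ v, cls v = p → v ≠ a p → (f p v ∈ O ↔ v ∈ O) := by
      intro v hv hne
      rw [← hO v, hτg, hg2 v (by rwa [hv]), hv]
    by_cases hfix : ρ (a p) = a p
    · have hba : b p = a p := by
        rcases hcases p _ (hb p) with h1 | h1 | h1 <;> simpa [hfix] using h1
      rw [if_pos hfix, hba]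
      refine ⟨Iff.rfl, ?_⟩
      split_ifs <;> rfl
    · have hs1 := hstep (ρ (a p)) (by rw [hclsρ, ha]) hfix
      have hs2 := hstep (ρ (ρ (a p))) (by rw [hclsρ, hclsρ, ha]) (h.rot.sq_ne hfix).1
      rw [if_neg hfix]
      by_cases h1 : a p = b p
      · simp only [f, classPerm, if_pos h1, Equiv.swap_apply_left] at hs1
        rw [← h1]
        refine ⟨Iff.rfl, ?_⟩
        simp only [hs1]
        split_ifs <;> rfl
      · by_cases h2 : b p = ρ (a p)
        · simp only [f, classPerm, if_neg h1, if_pos h2, hρ3] at hs1 hs2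
          rw [h2]
          refine ⟨by rw [← hs1, hs2], ?_⟩
          simp only [hs2, hs1]
          split_ifs <;> rfl
        · have h3 : b p = ρ (ρ (a p)) := by
            rcases hcases p _ (hb p) with h4 | h4 | h4
            · exact absurd h4.symm h1
            · exact absurd h4 h2
            · exact h4
          simp only [f, classPerm, if_neg h1, if_neg h2, Equiv.Perm.mul_apply, hρ3] at hs1 hs2
          rw [h3]
          refine ⟨by rw [← hs2, hs1], ?_⟩
          simp only [← hs2, hs1]
          split_ifs <;> rfl
  refine ⟨τ, ?_, hg1, ?_, fun O hO p => (hboth O hO p).1, fun O hO p => (hboth O hO p).2⟩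
  · intro v
    rw [hτg]
    by_cases hv : v = a (cls v)
    · rw [hv, hg1]; exact hadj _
    · rw [hg2 v hv]
      exact h.adj_of_cls_eq (hfcls _ _ rfl).symm (hfne _ _ rfl hv).symm
  · intro v hv
    rw [hτg, hg2 v hv]
    exact hfcls _ _ rfl

namespace IsLift

variable {a b : N → V} {σ : Equiv.Perm N} {τ : Equiv.Perm V} (h : IsLift G cls a b σ τ)
include h

/-- By `parity`, `O` has as many nodes modulo 2 as it enters classes, so that number is odd. It is
not 1, since with `p` the class `σ p ≠ p` is entered too. -/
theorem three_le_card (hσ : ∀ p, σ p ≠ p) {O : Finset V} (hO : ∀ v, τ v ∈ O ↔ v ∈ O)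
    (hodd : Odd O.card) : 3 ≤ (Finset.univ.filter fun p => b p ∈ O).card := by
  have hmod : (Finset.univ.filter fun p => b p ∈ O).card % 2 = 1 := by
    have h1 : O.card = ∑ p, ∑ v with cls v = p, if v ∈ O then 1 else 0 := by
      rw [Finset.sum_fiberwise]
      simp
    rw [Nat.odd_iff, h1, Finset.sum_nat_mod] at hodd
    simp only [h.parity O hO] at hodd
    rw [← hodd, Finset.card_filter]
  obtain ⟨p, hp⟩ : (Finset.univ.filter fun p => b p ∈ O).Nonempty := by
    rw [← Finset.card_pos]; omega
  have hp2 : σ p ∈ Finset.univ.filter fun p => b p ∈ O := by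
    simp only [Finset.mem_filter, Finset.mem_univ, true_and] at hp ⊢
    rwa [← h.exit, hO, ← h.mem_iff O hO]
  have : 1 < (Finset.univ.filter fun p => b p ∈ O).card :=
    Finset.one_lt_card.2 ⟨p, hp, σ p, hp2, (hσ p).symm⟩
  omega

/-- Distinct orbits enter disjoint sets of classes, as each class has one entry node. -/
theorem three_mul_card_oddOrbits_le (hσ : ∀ p, σ p ≠ p) :
    3 * (oddOrbits τ).card ≤ Fintype.card N := by
  have hmem : ∀ O ∈ oddOrbits τ, (∃ v, O = orbitFinset τ v) ∧ Odd O.card := by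
    intro O hO
    simp only [oddOrbits, Finset.mem_filter, Finset.mem_image, Finset.mem_univ, true_and] at hO
    obtain ⟨⟨v, rfl⟩, h2⟩ := hO
    exact ⟨⟨v, rfl⟩, h2⟩
  calc 3 * (oddOrbits τ).card = ∑ O ∈ oddOrbits τ, 3 := by simp [mul_comm]
    _ ≤ ∑ O ∈ oddOrbits τ, (Finset.univ.filter fun p => b p ∈ O).card := by
        refine Finset.sum_le_sum fun O hO => ?_
        obtain ⟨⟨v, rfl⟩, h2⟩ := hmem O hO
        exact h.three_le_card hσ (fun u => apply_mem_orbitFinset) h2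
    _ = ((oddOrbits τ).biUnion fun O => Finset.univ.filter fun p => b p ∈ O).card := by
        rw [Finset.card_biUnion]
        intro O hO O' hO' hne
        obtain ⟨⟨v, rfl⟩, -⟩ := hmem O hO
        obtain ⟨⟨v', rfl⟩, -⟩ := hmem O' hO'
        rw [Function.onFun, Finset.disjoint_left]
        intro p hp hp'
        simp only [Finset.mem_filter, Finset.mem_univ, true_and] at hp hp'
        exact hne ((orbitFinset_eq hp).symm.trans (orbitFinset_eq hp'))
    _ ≤ Fintype.card N := Finset.card_le_univ _

/-- An orbit of size three is odd, so it enters three classes and has one node in each. It spans a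
triangle of G all of whose edges cross. By maximality one of its nodes is rotated by `ρ`, but such a
node has only one crossing edge. -/
theorem apply_three_ne (hσ : ∀ p, σ p ≠ p) (hb : ∀ p, cls (b p) = p)
    (hc : IsContraction G ρ cls) (hG : G.IsRegularOfDegree 3)
    (hmax : ∀ a b c, G.Adj a b → G.Adj b c → G.Adj c a → ρ a ≠ a ∨ ρ b ≠ b ∨ ρ c ≠ c) (v : V) :
    τ (τ (τ v)) ≠ v := by
  intro h3
  have key : ∀ u, τ (τ (τ u)) = u → ρ u = u := by
    intro u hu
    by_contra hrot
    have hper : Function.minimalPeriod τ u = 3 := by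
      have hdvd : Function.minimalPeriod τ u ∣ 3 := Function.IsPeriodicPt.minimalPeriod_dvd hu
      rcases (Nat.dvd_prime Nat.prime_three).1 hdvd with h4 | h4
      · exact absurd (Function.minimalPeriod_eq_one_iff_isFixedPt.1 h4) (h.adj u).ne'
      · exact h4
    set O := orbitFinset τ u with hOdef
    have hO : ∀ v, τ v ∈ O ↔ v ∈ O := fun v => apply_mem_orbitFinset
    have hcard : O.card = 3 := by rw [hOdef, card_orbitFinset, hper]
    have hT := h.three_le_card hσ hO (by rw [hcard]; decide)
    have himg : (Finset.univ.filter fun p => b p ∈ O).image b = O := by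
      refine Finset.eq_of_subset_of_card_le ?_ ?_
      · intro x hx
        obtain ⟨p, hp, rfl⟩ := Finset.mem_image.1 hx
        simpa using hp
      · rw [Finset.card_image_of_injective _ (fun p q hpq => by rw [← hb p, hpq, hb]), hcard]
        exact hT
    have hinj : ∀ x ∈ O, ∀ y ∈ O, cls x = cls y → x = y := by
      intro x hx y hy hxy
      rw [← himg] at hx hy
      obtain ⟨p, -, rfl⟩ := Finset.mem_image.1 hx
      obtain ⟨q, -, rfl⟩ := Finset.mem_image.1 hy
      rw [hb, hb] at hxy
      rw [hxy]
    have h0 : u ∈ O := self_mem_orbitFinset u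
    have h1 : τ u ∈ O := (hO _).2 h0
    have h2 : τ (τ u) ∈ O := (hO _).2 h1
    have hadj2 : G.Adj u (τ (τ u)) := by
      have := h.adj (τ (τ u))
      rw [hu] at this
      exact this.symm
    have hcross := hc.card_crossing hG u
    rw [if_neg hrot] at hcross
    have hle := Finset.card_le_card (s := {τ u, τ (τ u)})
      (t := Finset.univ.filter fun w => G.Adj u w ∧ cls w ≠ cls u) (by
        intro x hx
        simp only [Finset.mem_insert, Finset.mem_singleton] at hx
        simp only [Finset.mem_filter, Finset.mem_univ, true_and]
        rcases hx with rfl | rfl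
        · exact ⟨h.adj u, fun h5 => (h.adj u).ne' (hinj _ h1 _ h0 h5)⟩
        · exact ⟨hadj2, fun h5 => hadj2.ne' (hinj _ h2 _ h0 h5)⟩)
    rw [hcross, Finset.card_pair (h.adj _).ne] at hle
    omega
  rcases hmax v (τ v) (τ (τ v)) (h.adj _) (h.adj _) (by simpa only [h3] using h.adj (τ (τ v)))
    with h1 | h1 | h1
  · exact h1 (key _ h3)
  · exact h1 (key _ (congrArg τ h3))
  · exact h1 (key _ (congrArg (fun x => τ (τ x)) h3))

end IsLift

/-- Since `σ` has no fixed point, `a p` is the only node of class `p` that `τ` moves out of the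
class; so `τ` determines the exits and then the chosen arcs. -/
theorem IsLift.unique {a b a' b' : N → V} {σ σ' : Equiv.Perm N} {τ : Equiv.Perm V}
    (hσ : ∀ p, σ p ≠ p) (h : IsLift G cls a b σ τ) (h' : IsLift G cls a' b' σ' τ)
    (ha : ∀ p, cls (a p) = p) (hb : ∀ p, cls (b p) = p) (hb' : ∀ p, cls (b' p) = p) :
    a = a' ∧ σ = σ' ∧ ∀ p, b (σ p) = b' (σ' p) := by
  have haa : a = a' := by
    funext p
    by_contra hne
    have h1 := h'.inner (a p) (by rwa [ha])
    rw [h.exit, hb, ha] at h1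
    exact hσ p h1
  have hbb : ∀ p, b (σ p) = b' (σ' p) := fun p => by
    rw [← h.exit, ← h'.exit, haa]
  refine ⟨haa, Equiv.ext fun p => ?_, hbb⟩
  rw [← hb (σ p), hbb, hb']

end Lift

/-! ### Combining the lower and upper bounds on the permanent -/

section Count

theorem IsContraction.permanent_le {V N : Type*} [Fintype V] [DecidableEq V] {G : SimpleGraph V}
    [DecidableRel G.Adj] {ρ : Equiv.Perm V} [Fintype N] [DecidableEq N] {cls : V → N}
    (hc : IsContraction G ρ cls) (hG : G.IsRegularOfDegree 3)
    (hmax : ∀ a b c, G.Adj a b → G.Adj b c → G.Adj c a → ρ a ≠ a ∨ ρ b ≠ b ∨ ρ c ≠ c) :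
    Matrix.permanent (Matrix.of fun q p => (crossingArcs G cls p q).card) ≤
      2 ^ (Fintype.card N / 3) * (goodMatchings G).ncard ^ 2 := by
  classical
  -- The permanent is the number of pairs of a permutation of the classes and a crossing arc from
  -- each class to its image.
  let S : Finset (Σ _ : Equiv.Perm N, N → V × V) :=
    Finset.univ.sigma fun σ => Fintype.piFinset fun p => crossingArcs G cls p (σ p)
  have hS : ∀ x ∈ S, ∀ p, G.Adj (x.2 p).1 (x.2 p).2 ∧ cls (x.2 p).1 = p ∧
      cls (x.2 p).2 = x.1 p ∧ x.1 p ≠ p := by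
    intro x hx p
    simp only [S, Finset.mem_sigma, Finset.mem_univ, true_and, Fintype.mem_piFinset,
      mem_crossingArcs] at hx
    exact hx p
  have hcard : Matrix.permanent (Matrix.of fun q p => (crossingArcs G cls p q).card) =
      S.card := by
    simp [S, Matrix.permanent, Finset.card_sigma, Fintype.card_piFinset]
  have hlift : ∀ x : S, ∃ τ, IsLift G cls (fun p => (x.1.2 p).1)
      (fun q => (x.1.2 (x.1.1.symm q)).2) x.1.1 τ := by
    intro x
    have := hS x.1 x.2
    refine hc.exists_lift _ _ (fun p => (this p).2.1) (fun p => ?_) _ (fun p => ?_)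
    · rw [(this _).2.2.1, Equiv.apply_symm_apply]
    · rw [Equiv.symm_apply_apply]
      exact (this p).1
  choose F hF using hlift
  have hclsb : ∀ (x : S) q, cls (x.1.2 (x.1.1.symm q)).2 = q := fun x q => by
    rw [(hS x.1 x.2 _).2.2.1, Equiv.apply_symm_apply]
  have hinj : Function.Injective F := by
    intro x y hxy
    have h1 := hF x
    rw [hxy] at h1
    obtain ⟨h2, h3, h4⟩ := IsLift.unique (fun p => (hS x.1 x.2 p).2.2.2) h1 (hF y)
      (fun p => (hS x.1 x.2 p).2.1) (hclsb x) (hclsb y)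
    simp only [Equiv.symm_apply_apply] at h4
    refine Subtype.ext (Sigma.ext h3 (heq_of_eq (funext fun p => Prod.ext (congrFun h2 p) (h4 p))))
  have himg : S.card = (Finset.univ.image F).card := by
    rw [Finset.card_image_of_injective _ hinj, Finset.card_univ, Fintype.card_coe]
  have hP : ∀ {Q : Equiv.Perm V → Prop}, (∀ x, Q (F x)) → ∀ τ ∈ Finset.univ.image F, Q τ := by
    intro Q hQ τ hτ
    obtain ⟨x, -, rfl⟩ := Finset.mem_image.1 hτ
    exact hQ x
  rw [hcard, himg]
  refine card_le_two_pow_mul_sq _ (hP fun x => (hF x).adj) (hP fun x => ?_) _ (hP fun x => ?_)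
  · exact (hF x).apply_three_ne (fun p => (hS x.1 x.2 p).2.2.2) (hclsb x) hc hG hmax
  · rw [Nat.le_div_iff_mul_le (by norm_num), mul_comm]
    exact (hF x).three_mul_card_oddOrbits_le fun p => (hS x.1 x.2 p).2.2.2

theorem isContraction_quotient {V : Type*} [Fintype V] [DecidableEq V] {G : SimpleGraph V}
    {ρ : Equiv.Perm V} (h : IsTriangleRotation G ρ) :
    IsContraction G ρ (Quotient.mk (Equiv.Perm.SameCycle.setoid ρ)) where
  rot := h
  surj := Quotient.mk_surjective
  cls_eq v w := by
    rw [Quotient.eq]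
    change ρ.SameCycle v w ↔ _
    constructor
    · intro hs
      obtain ⟨i, rfl⟩ := hs.exists_nat_pow_eq
      clear hs
      induction i with
      | zero => simp
      | succ i ih =>
        rw [pow_succ', Equiv.Perm.mul_apply]
        rcases ih with h1 | h1 | h1 <;> rw [h1]
        · simp
        · simp
        · simp [h.cube]
    · rintro (rfl | rfl | rfl)
      · exact Equiv.Perm.SameCycle.refl _ _
      · exact ⟨1, by simp⟩
      · exact ⟨2, by rw [zpow_two]; rfl⟩

/-- Cubing turns 2^(m/3) into at most 2^m and leaves 64/2 = 32 against 27. Cubing again trades m for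
3m ≥ n, and the surplus factors are dropped because 27 ≤ 32. -/
theorem pow_le_of_permanent_bounds {m n P B : ℕ} (h1 : 4 ^ m ≤ 3 ^ m * P)
    (h2 : P ≤ 2 ^ (m / 3) * B ^ 2) (h3 : n ≤ 3 * m) : 32 ^ n ≤ 27 ^ n * B ^ 18 := by
  have h4 : 64 ^ m ≤ 27 ^ m * P ^ 3 := by
    have := Nat.pow_le_pow_left h1 3
    rw [mul_pow, ← pow_mul, ← pow_mul, mul_comm m 3, pow_mul, pow_mul] at this
    exact this
  have h5 : P ^ 3 ≤ 2 ^ m * B ^ 6 := by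
    calc P ^ 3 ≤ (2 ^ (m / 3) * B ^ 2) ^ 3 := Nat.pow_le_pow_left h2 3
      _ = 2 ^ (m / 3 * 3) * B ^ 6 := by rw [mul_pow, ← pow_mul, ← pow_mul]
      _ ≤ 2 ^ m * B ^ 6 :=
        Nat.mul_le_mul_right _ (Nat.pow_le_pow_right two_pos (Nat.div_mul_le_self m 3))
  have h6 : 32 ^ m ≤ 27 ^ m * B ^ 6 := by
    have : 2 ^ m * 32 ^ m ≤ 2 ^ m * (27 ^ m * B ^ 6) := by
      rw [← mul_pow]
      calc (2 * 32) ^ m ≤ 27 ^ m * P ^ 3 := h4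
        _ ≤ 27 ^ m * (2 ^ m * B ^ 6) := Nat.mul_le_mul_left _ h5
        _ = _ := by ring
    exact Nat.le_of_mul_le_mul_left this (by positivity)
  have h7 : 32 ^ (3 * m) ≤ 27 ^ (3 * m) * B ^ 18 := by
    have := Nat.pow_le_pow_left h6 3
    rw [mul_pow, ← pow_mul, ← pow_mul, ← pow_mul, mul_comm m 3] at this
    exact this
  obtain ⟨k, hk⟩ := Nat.exists_eq_add_of_le h3
  have h8 : 27 ^ k * 32 ^ n ≤ 27 ^ k * (27 ^ n * B ^ 18) := by
    calc 27 ^ k * 32 ^ n ≤ 32 ^ k * 32 ^ n :=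
          Nat.mul_le_mul_right _ (Nat.pow_le_pow_left (by norm_num) k)
      _ = 32 ^ (3 * m) := by rw [← pow_add, add_comm, hk]
      _ ≤ 27 ^ (3 * m) * B ^ 18 := h7
      _ = 27 ^ k * (27 ^ n * B ^ 18) := by rw [hk, pow_add]; ring
  exact Nat.le_of_mul_le_mul_left h8 (by positivity)

theorem pow_card_le_ncard_goodMatchings {V : Type*} [Fintype V] [DecidableEq V]
    (G : SimpleGraph V) [DecidableRel G.Adj] (hG : G.IsRegularOfDegree 3) :
    32 ^ Fintype.card V ≤ 27 ^ Fintype.card V * (goodMatchings G).ncard ^ 18 := by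
  classical
  obtain ⟨ρ, hρ, hmax⟩ := exists_maximal_triangleRotation G
  have hc := isContraction_quotient hρ
  exact pow_le_of_permanent_bounds (hc.cubicMatrix hG).four_pow_le (hc.permanent_le hG hmax)
    hc.card_le

end Count

end CubicTwoMatching

theorem mainTheorem8 :
    ∃ c : ℝ, 1 < c ∧
      ∀ (V : Type*) [Fintype V] [DecidableEq V] (G : SimpleGraph V) [DecidableRel G.Adj],
        G.IsRegularOfDegree 3 →
          c ^ Fintype.card V ≤
            (({x : G.edgeSet → Fin 3 |
                CubicTwoMatching.IsTwoMatching G x ∧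
                CubicTwoMatching.IsBasic G x ∧
                CubicTwoMatching.IsPerfect G x ∧
                CubicTwoMatching.IsTriangleFree G x}.ncard : ℕ) : ℝ) := by
  -- Any c > 1 with c^18 ≤ 32/27 works.
  refine ⟨1.005, by norm_num, ?_⟩
  intro V _ _ G _ hG
  have h := CubicTwoMatching.pow_card_le_ncard_goodMatchings G hG
  rw [CubicTwoMatching.goodMatchings] at h
  generalize Set.ncard _ = B at h ⊢
  have h' : (32 : ℝ) ^ Fintype.card V ≤ 27 ^ Fintype.card V * (B : ℝ) ^ 18 := by exact_mod_cast h
  refine le_of_pow_le_pow_left₀ (n := 18) (by norm_num) (by positivity) ?_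
  have h27 : (0 : ℝ) < 27 ^ Fintype.card V := by positivity
  refine le_of_mul_le_mul_left (le_trans ?_ h') h27
  rw [← pow_mul, mul_comm (Fintype.card V) 18, pow_mul, ← mul_pow]
  exact pow_le_pow_left₀ (by norm_num) (by norm_num) _
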